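/- Let $(M,J)$ be a smooth almost complex manifold (finite-dimensional, Hausdorff, without boundary; $J$ is a smooth field of endomorphisms of the tangent spaces with $J^2=-\mathrm{id}$), and let $\nabla$ be a smooth torsion-free affine connection on $M$ (for instance the Levi-Civita connection of a pseudo-Riemannian metric), with curvature tensor $R(X,Y)Z=\nabla_X\nabla_YZ-\nabla_Y\nabla_XZ-\nabla_{[X,Y]}Z$. For $u\in T_pM$ let $v^V\in T_u(TM)$ be the vertical lift of $v\in T_pM$ (the velocity at $t=0$ of $t\mapsto u+tv$), and let $h^H\in T_u(TM)$ be the horizontal lift of $h\in T_pM$ with respect to $\nabla$ (that is, $h^H=ds_p(h)-(\nabla_hs)^V$ for any local vector field $s$ with $s(p)=u$; in the coordinates $(x^k,y^k)$ induced on $TM$ by coordinates of $M$, $v^V=(0,v^k)$ and $h^H=(h^k,-y^i\Gamma_{ij}^kh^j)$). For a vector field $X$ on $M$, $X^V$ and $X^H$ are the vector fields $u\mapsto (X_{\pi(u)})^V$, $u\mapsto (X_{\pi(u)})^H$ on $TM$. Define $H=(J_1,J_2,J_3)$ on $TM$ by $$J_1:\ X^H\mapsto X^V,\ X^V\mapsto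 -X^H;\qquad J_2:\ X^H\mapsto (JX)^V,\ X^V\mapsto (JX)^H;\qquad J_3=J_1\circ J_2,$$ and let $N_\alpha$ be the Nijenhuis tensor of $J_\alpha$: $$N_\alpha(\tilde X,\tilde Y)=[\tilde X,\tilde Y]+J_\alpha[J_\alpha\tilde X,\tilde Y]+J_\alpha[\tilde X,J_\alpha\tilde Y]-[J_\alpha\tilde X,J_\alpha\tilde Y].$$ Then for all smooth vector fields $X,Y$ on $M$, at every $u\in T_pM$: $$\begin{aligned} &-N_1(X^H,Y^H)=N_1(X^V,Y^V)=\{R(X,Y)u\}^V,\\ &N_1(X^H,Y^V)=N_1(X^V,Y^H)=-\{R(X,Y)u\}^H; \end{aligned}$$ $$\begin{aligned} &N_2(X^H,Y^H)=\{J(\nabla_XJ)(Y)-J(\nabla_YJ)(X)\}^H-\{R(X,Y)u\}^V,\\ &N_2(X^V,Y^V)=-\{(\nabla_{JX}J)(Y)-(\nabla_{JY}J)(X)\}^H+\{R(JX,JY)u\}^V,\\ &N_2(X^H,Y^V)=\{J(\nabla_XJ)(Y)+(\nabla_{JY}J)(X)\}^V-\{JR(X,JY)u\}^H,\\ &N_2(X^V,Y^H)=-\{(\nabla_{JX}J)(Y)+J(\nabla_YJ)(X)\}^V-\{JR(JX,Y)u\}^H;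 \end{aligned}$$ $$\begin{aligned} &N_3(X^H,Y^H)=\{N_J(X,Y)\}^H+\{-R(X,Y)u+R(JX,JY)u+JR(JX,Y)u+JR(X,JY)u\}^V,\\ &N_3(X^H,Y^V)=\{(\nabla_{JX}J)(Y)-(\nabla_XJ)(JY)\}^V,\\ &N_3(X^V,Y^H)=\{(\nabla_YJ)(JX)-(\nabla_{JY}J)(X)\}^V,\qquad N_3(X^V,Y^V)=0, \end{aligned}$$ where $$N_J(X,Y)=J(\nabla_XJ)(Y)-J(\nabla_YJ)(X)-(\nabla_{JX}J)(Y)+(\nabla_{JY}J)(X),$$ and this is the Nijenhuis tensor $[X,Y]+J[JX,Y]+J[X,JY]-[JX,JY]$ of $J$ on $M$. -/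

import Mathlib

open Bundle FiberBundle VectorField
open scoped Manifold ContDiff

noncomputable section

namespace LiftGeometry

section Tensors

variable {E : Type*} [NormedAddCommGroup E] [NormedSpace ℝ E]
  {H : Type*} [TopologicalSpace H] (I : ModelWithCorners ℝ E H)
  {M : Type*} [TopologicalSpace M] [ChartedSpace H M]

/-- The Nijenhuis tensor of a field `A` of endomorphisms of the tangent spaces, evaluated on vector
fields: `N(X, Y) = [X, Y] + A[AX, Y] + A[X, AY] - [AX, AY]`. -/
def nijenhuis (A : ∀ p : M, TangentSpace I p →L[ℝ] TangentSpace I p)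
    (X Y : ∀ p : M, TangentSpace I p) (p : M) : TangentSpace I p :=
  mlieBracket I X Y p
    + A p (mlieBracket I (fun q => A q (X q)) Y p)
    + A p (mlieBracket I X (fun q => A q (Y q)) p)
    - mlieBracket I (fun q => A q (X q)) (fun q => A q (Y q)) p

end Tensors

variable {E : Type*} [NormedAddCommGroup E] [NormedSpace ℝ E]
  {M : Type*} [TopologicalSpace M] [ChartedSpace E M] [IsManifold 𝓘(ℝ, E) ∞ M]

/-- `X` is a smooth vector field on `M`. -/
def SmoothField (X : ∀ p : M, TangentSpace 𝓘(ℝ, E) p) : Prop :=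
  ContMDiff 𝓘(ℝ, E) 𝓘(ℝ, E).tangent ∞ (fun p => (⟨p, X p⟩ : TangentBundle 𝓘(ℝ, E) M))

/-- `J` is an almost complex structure on `M`: a smooth field of endomorphisms of the tangent
spaces with `J² = -1`. -/
structure IsAlmostComplex
    (J : ∀ p : M, TangentSpace 𝓘(ℝ, E) p →L[ℝ] TangentSpace 𝓘(ℝ, E) p) : Prop where
  smooth : ContMDiff 𝓘(ℝ, E) (𝓘(ℝ, E).prod 𝓘(ℝ, E →L[ℝ] E)) ∞
    (fun p => (⟨p, J p⟩ : TotalSpace (E →L[ℝ] E)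
      (fun p : M => TangentSpace 𝓘(ℝ, E) p →L[ℝ] TangentSpace 𝓘(ℝ, E) p)))
  sq_eq_neg : ∀ (p : M) (v : TangentSpace 𝓘(ℝ, E) p), J p (J p v) = -v

/-- Affine connections on `M`. As everywhere in Mathlib, `∇_X Y` at `p` is `cov Y p (X p)`. -/
abbrev Connection (E : Type*) [NormedAddCommGroup E] [NormedSpace ℝ E]
    (M : Type*) [TopologicalSpace M] [ChartedSpace E M] [IsManifold 𝓘(ℝ, E) ∞ M] :=
  CovariantDerivative 𝓘(ℝ, E) E (TangentSpace 𝓘(ℝ, E) : M → Type _)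

variable (cov : Connection E M)

/-- `R(X, Y)Z = ∇_X ∇_Y Z - ∇_Y ∇_X Z - ∇_[X,Y] Z`, for vector fields. -/
def curvatureField (X Y Z : ∀ p : M, TangentSpace 𝓘(ℝ, E) p) (p : M) : TangentSpace 𝓘(ℝ, E) p :=
  cov (fun q => cov Z q (Y q)) p (X p) - cov (fun q => cov Z q (X q)) p (Y p)
    - cov Z p (mlieBracket 𝓘(ℝ, E) X Y p)

/-- The value `R(x, y)z` of the curvature tensor on tangent vectors at `p`, computed with the
extensions of `x`, `y`, `z` to vector fields that are constant in the preferred trivialization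
at `p`. -/
def curvature {p : M} (x y z : TangentSpace 𝓘(ℝ, E) p) : TangentSpace 𝓘(ℝ, E) p :=
  curvatureField cov (extend E x) (extend E y) (extend E z) p

/-- The value `(∇_x J)(y) = ∇_x (JY) - J ∇_x Y` on tangent vectors at `p`, where the vector field
`Y` extends `y` and is constant in the preferred trivialization at `p`. -/
def nablaEnd (J : ∀ p : M, TangentSpace 𝓘(ℝ, E) p →L[ℝ] TangentSpace 𝓘(ℝ, E) p)
    {p : M} (x y : TangentSpace 𝓘(ℝ, E) p) : TangentSpace 𝓘(ℝ, E) p :=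
  cov (fun q => J q (extend E y q)) p x - J p (cov (extend E y) p x)

/-! ### Vertical and horizontal lifts -/

/-- The vertical lift of `v ∈ T_pM` to `T_u(TM)`, `u ∈ T_pM`: the velocity at `t = 0` of the curve
`t ↦ u + t v` in the fibre `T_pM`. -/
def vert (u : TangentBundle 𝓘(ℝ, E) M) (v : TangentSpace 𝓘(ℝ, E) u.1) :
    TangentSpace 𝓘(ℝ, E).tangent u :=
  mfderiv 𝓘(ℝ, ℝ) 𝓘(ℝ, E).tangent
    (fun t : ℝ => (⟨u.1, u.2 + t • v⟩ : TangentBundle 𝓘(ℝ, E) M)) 0 (1 : ℝ)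

/-- The horizontal lift of `h ∈ T_pM` to `T_u(TM)`, `u ∈ T_pM`: it is `ds(h) - (∇_h s)^V`, where the
vector field `s` on `M` extends `u` and is constant in the preferred trivialization at `p` (so that `s(p) = u`). -/
def hor (u : TangentBundle 𝓘(ℝ, E) M) (h : TangentSpace 𝓘(ℝ, E) u.1) :
    TangentSpace 𝓘(ℝ, E).tangent u :=
  let w : TangentSpace 𝓘(ℝ, E).tangent u :=
    mfderiv 𝓘(ℝ, E) 𝓘(ℝ, E).tangent
      (fun q => (⟨q, extend E u.2 q⟩ : TangentBundle 𝓘(ℝ, E) M)) u.1 h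
  w - vert u (cov (extend E u.2) u.1 h)

/-- The vertical lift `X^V` of a vector field. -/
def vertLift (X : ∀ p : M, TangentSpace 𝓘(ℝ, E) p) (u : TangentBundle 𝓘(ℝ, E) M) :
    TangentSpace 𝓘(ℝ, E).tangent u :=
  vert u (X u.1)

/-- The horizontal lift `X^H` of a vector field. -/
def horLift (X : ∀ p : M, TangentSpace 𝓘(ℝ, E) p) (u : TangentBundle 𝓘(ℝ, E) M) :
    TangentSpace 𝓘(ℝ, E).tangent u :=
  hor cov u (X u.1)

theorem line_contDiff (a b : E) :
    ContMDiffAt 𝓘(ℝ, ℝ) 𝓘(ℝ, E) 1 (fun t : ℝ => a + t • b) 0 := by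
  rw [contMDiffAt_iff_contDiffAt]
  have : ContDiff ℝ 1 (fun t : ℝ => a + t • b) := by fun_prop
  exact this.contDiffAt

theorem line_fderiv (c a b : E) :
    fderivWithin ℝ (fun t : ℝ => (c, a + t • b)) (Set.range 𝓘(ℝ, ℝ))
      (extChartAt 𝓘(ℝ, ℝ) (0 : ℝ) 0) 1 = (0, b) := by
  have h0 : HasDerivAt (fun t : ℝ => a + t • b) b 0 := by
    simpa using ((hasDerivAt_id (0 : ℝ)).smul_const b).const_add a
  have h1 : HasDerivAt (fun t : ℝ => (c, a + t • b)) ((0 : E), b) 0 :=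
    (hasDerivAt_const _ _).prodMk h0
  simp only [modelWithCornersSelf_coe, Set.range_id, fderivWithin_univ]
  exact h1.deriv

theorem const_fderiv (a x h : E) :
    fderiv ℝ (fun x : E => (x, a)) x h = (h, 0) := by
  have h1 : HasFDerivAt (fun x : E => (x, a)) ((ContinuousLinearMap.id ℝ E).prod 0) x :=
    (hasFDerivAt_id _).prodMk (hasFDerivAt_const _ _)
  simp [h1.fderiv]

theorem triv_self (u : TangentBundle 𝓘(ℝ, E) M) :
    trivializationAt E (TangentSpace 𝓘(ℝ, E)) u.1 u = (u.1, u.2) :=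
  Prod.ext rfl ((tangentBundleCore 𝓘(ℝ, E) M).coordChange_self (achart E u.1) u.1
    (mem_achart_source E u.1) _)

/-- In the induced coordinates, `v^V` has components `(0, v)`. -/
theorem vert_eq (u : TangentBundle 𝓘(ℝ, E) M) (v : TangentSpace 𝓘(ℝ, E) u.1) :
    vert u v = ((0, v) : E × E) := by
  have h (t : ℝ) : trivializationAt E (TangentSpace 𝓘(ℝ, E)) u.1
      (⟨u.1, u.2 + t • v⟩ : TangentBundle 𝓘(ℝ, E) M) = (u.1, u.2 + t • v) :=
    triv_self (⟨u.1, u.2 + t • v⟩ : TangentBundle 𝓘(ℝ, E) M)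
  have hc : ContMDiffAt 𝓘(ℝ, ℝ) 𝓘(ℝ, E).tangent 1
      (fun t : ℝ => (⟨u.1, u.2 + t • v⟩ : TangentBundle 𝓘(ℝ, E) M)) 0 := by
    rw [Bundle.contMDiffAt_totalSpace]
    refine ⟨contMDiffAt_const, ?_⟩
    simp only [h]
    exact line_contDiff (E := E) u.2 v
  have hd := hc.mdifferentiableAt (by simp)
  rw [vert, hd.mfderiv]
  have hw : writtenInExtChartAt 𝓘(ℝ, ℝ) 𝓘(ℝ, E).tangent 0
      (fun t : ℝ => (⟨u.1, u.2 + t • v⟩ : TangentBundle 𝓘(ℝ, E) M)) =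
        fun t : ℝ => (extChartAt 𝓘(ℝ, E) u.1 u.1, (u.2 : E) + t • (v : E)) := by
    ext1 t
    refine Prod.ext rfl ?_
    have h2 := congrArg Prod.snd (h t)
    exact h2
  rw [hw]
  exact line_fderiv (E := E) (extChartAt 𝓘(ℝ, E) u.1 u.1) u.2 v

/-- In the induced coordinates, `h^H` has components `(h, -Γ(h, u))`. -/
theorem hor_eq (u : TangentBundle 𝓘(ℝ, E) M) (h : TangentSpace 𝓘(ℝ, E) u.1) :
    hor cov u h = ((h, -cov (extend E u.2) u.1 h) : E × E) := by
  have hd : MDifferentiableAt 𝓘(ℝ, E) 𝓘(ℝ, E).tangent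
      (fun q => (⟨q, extend E u.2 q⟩ : TangentBundle 𝓘(ℝ, E) M)) u.1 :=
    mdifferentiableAt_extend ..
  have h1 : (mfderiv 𝓘(ℝ, E) 𝓘(ℝ, E).tangent
      (fun q => (⟨q, extend E u.2 q⟩ : TangentBundle 𝓘(ℝ, E) M)) u.1 h : E × E) = (h, 0) := by
    rw [hd.mfderiv]
    have h2 : writtenInExtChartAt 𝓘(ℝ, E) 𝓘(ℝ, E).tangent u.1
        (fun q => (⟨q, extend E u.2 q⟩ : TangentBundle 𝓘(ℝ, E) M))
          =ᶠ[nhds (extChartAt 𝓘(ℝ, E) u.1 u.1)] fun x => (x, (u.2 : E)) := by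
      filter_upwards [extChartAt_target_mem_nhds (I := 𝓘(ℝ, E)) u.1] with x hx
      have hs : (extChartAt 𝓘(ℝ, E) u.1).symm x ∈
          (trivializationAt E (TangentSpace 𝓘(ℝ, E)) u.1).baseSet := by
        have := (extChartAt 𝓘(ℝ, E) u.1).map_target hx
        rwa [extChartAt_source] at this
      refine Prod.ext ?_ ?_
      · exact (extChartAt 𝓘(ℝ, E) u.1).right_inv hx
      · have := (trivializationAt E (TangentSpace 𝓘(ℝ, E)) u.1).apply_mk_symm hs (u.2 : E)
        have e : (trivializationAt E (TangentSpace 𝓘(ℝ, E)) u.1 ⟨u.1, u.2⟩).2 = u.2 :=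
          congrArg Prod.snd (triv_self u)
        change (trivializationAt E (TangentSpace 𝓘(ℝ, E)) u.1
          ⟨(extChartAt 𝓘(ℝ, E) u.1).symm x, extend E u.2 _⟩).2 = _
        rw [extend, e, this]
    simp only [modelWithCornersSelf_coe, Set.range_id, fderivWithin_univ]
    rw [h2.fderiv_eq]
    exact const_fderiv (E := E) u.2 _ h
  unfold hor
  rw [vert_eq]
  dsimp only
  rw [h1]
  exact Prod.ext (sub_zero (h : E)) (zero_sub (_ : E))

def shear (Γ : E →L[ℝ] E) : (E × E) ≃L[ℝ] (E × E) where
  toFun w := (w.1, w.2 - Γ w.1)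
  invFun ξ := (ξ.1, ξ.2 + Γ ξ.1)
  map_add' w w' := by ext <;> simp; abel
  map_smul' c w := by ext <;> simp [smul_sub]
  left_inv w := by simp
  right_inv w := by simp
  continuous_toFun := by fun_prop
  continuous_invFun := by fun_prop

/-- The splitting `T_pM × T_pM ≃ T_u(TM)`, `(h, v) ↦ h^H + v^V`, of the tangent space of `TM` at
`u ∈ T_pM` into its horizontal and its vertical part (see `splitting_apply`); here it is written in
the induced coordinates. -/
def splitting (u : TangentBundle 𝓘(ℝ, E) M) :
    (TangentSpace 𝓘(ℝ, E) u.1 × TangentSpace 𝓘(ℝ, E) u.1) ≃L[ℝ]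
      TangentSpace 𝓘(ℝ, E).tangent u :=
  (shear (cov (extend E u.2) u.1) : (E × E) ≃L[ℝ] (E × E))

theorem splitting_apply (u : TangentBundle 𝓘(ℝ, E) M) (h v : TangentSpace 𝓘(ℝ, E) u.1) :
    splitting cov u (h, v) = hor cov u h + vert u v := by
  rw [hor_eq, vert_eq]
  refine Prod.ext ?_ ?_
  · exact (add_zero (h : E)).symm
  · exact (sub_eq_neg_add (v : E) _)

/-! ### The almost hypercomplex structure on `TM` -/

/-- `J₁ : h^H ↦ h^V, v^V ↦ -v^H`. -/
def J₁ (u : TangentBundle 𝓘(ℝ, E) M) :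
    TangentSpace 𝓘(ℝ, E).tangent u →L[ℝ] TangentSpace 𝓘(ℝ, E).tangent u :=
  (splitting cov u : _ →L[ℝ] _) ∘L
    ((-ContinuousLinearMap.snd ℝ (TangentSpace 𝓘(ℝ, E) u.1) (TangentSpace 𝓘(ℝ, E) u.1)).prod
      (ContinuousLinearMap.fst ℝ (TangentSpace 𝓘(ℝ, E) u.1) (TangentSpace 𝓘(ℝ, E) u.1))) ∘L
    ((splitting cov u).symm : _ →L[ℝ] _)

variable (J : ∀ p : M, TangentSpace 𝓘(ℝ, E) p →L[ℝ] TangentSpace 𝓘(ℝ, E) p)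

/-- `J₂ : h^H ↦ (Jh)^V, v^V ↦ (Jv)^H`. -/
def J₂ (u : TangentBundle 𝓘(ℝ, E) M) :
    TangentSpace 𝓘(ℝ, E).tangent u →L[ℝ] TangentSpace 𝓘(ℝ, E).tangent u :=
  (splitting cov u : _ →L[ℝ] _) ∘L
    ((J u.1 ∘L ContinuousLinearMap.snd ℝ (TangentSpace 𝓘(ℝ, E) u.1)
        (TangentSpace 𝓘(ℝ, E) u.1)).prod
      (J u.1 ∘L ContinuousLinearMap.fst ℝ (TangentSpace 𝓘(ℝ, E) u.1)
        (TangentSpace 𝓘(ℝ, E) u.1))) ∘L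
    ((splitting cov u).symm : _ →L[ℝ] _)

/-- `J₃ = J₁ ∘ J₂`. -/
def J₃ (u : TangentBundle 𝓘(ℝ, E) M) :
    TangentSpace 𝓘(ℝ, E).tangent u →L[ℝ] TangentSpace 𝓘(ℝ, E).tangent u :=
  J₁ cov u ∘L J₂ cov J u

theorem vert_zero (u : TangentBundle 𝓘(ℝ, E) M) :
    vert u (0 : TangentSpace 𝓘(ℝ, E) u.1) = 0 := by
  rw [vert_eq]; rfl

theorem hor_zero (u : TangentBundle 𝓘(ℝ, E) M) :
    hor cov u (0 : TangentSpace 𝓘(ℝ, E) u.1) = 0 := by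
  rw [hor_eq, map_zero, neg_zero]; rfl

theorem splitting_symm_hor (u : TangentBundle 𝓘(ℝ, E) M) (h : TangentSpace 𝓘(ℝ, E) u.1) :
    (splitting cov u).symm (hor cov u h) = (h, 0) := by
  rw [ContinuousLinearEquiv.symm_apply_eq, splitting_apply, vert_zero, add_zero]

theorem splitting_symm_vert (u : TangentBundle 𝓘(ℝ, E) M) (v : TangentSpace 𝓘(ℝ, E) u.1) :
    (splitting cov u).symm (vert u v) = (0, v) := by
  rw [ContinuousLinearEquiv.symm_apply_eq, splitting_apply, hor_zero, zero_add]

theorem J₁_hor (u : TangentBundle 𝓘(ℝ, E) M) (h : TangentSpace 𝓘(ℝ, E) u.1) :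
    J₁ cov u (hor cov u h) = vert u h := by
  simp [J₁, splitting_symm_hor, splitting_apply, hor_zero]

theorem J₁_vert (u : TangentBundle 𝓘(ℝ, E) M) (v : TangentSpace 𝓘(ℝ, E) u.1) :
    J₁ cov u (vert u v) = -hor cov u v := by
  have : hor cov u (-v) = -hor cov u v := by
    have h := (splitting cov u).map_neg (v, 0)
    simpa [splitting_apply, vert_zero] using h
  simp [J₁, splitting_symm_vert, splitting_apply, vert_zero, this]

theorem J₂_hor (u : TangentBundle 𝓘(ℝ, E) M) (h : TangentSpace 𝓘(ℝ, E) u.1) :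
    J₂ cov J u (hor cov u h) = vert u (J u.1 h) := by
  simp [J₂, splitting_symm_hor, splitting_apply, hor_zero]

theorem J₂_vert (u : TangentBundle 𝓘(ℝ, E) M) (v : TangentSpace 𝓘(ℝ, E) u.1) :
    J₂ cov J u (vert u v) = hor cov u (J u.1 v) := by
  simp [J₂, splitting_symm_vert, splitting_apply, vert_zero]

end LiftGeometry

end

open LiftGeometry

/-! Everything follows from three brackets on $TM$: $[X^V,Y^V]=0$, $[X^H,Y^V]=(\nabla_XY)^V$ and
$[X^H,Y^H]=[X,Y]^H-(R(X,Y)u)^V$ (`mlieBracket_vertLift_vertLift`, `mlieBracket_horLift_vertLift`,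
`mlieBracket_horLift_horLift`). Each $J_\alpha$ carries lifts to lifts up to sign, so each Nijenhuis
tensor expands into such brackets. Where two horizontal lifts meet, $[X,Y]=\nabla_XY-\nabla_YX$
replaces the base bracket. What remains is linear algebra with $J^2=-1$ and
$(\nabla_xJ)(Y)=\nabla_x(JY)-J\nabla_xY$, the latter for an arbitrary differentiable extension
(`IsAlmostComplex.nablaEnd_eq`).

The brackets are computed in the induced chart $(x,u)$ of $TM$, where $X^V=(0,X(x))$ and
$X^H=(X(x),-\Gamma_x(u,X(x)))$. A bracket needs these expressions on a whole neighbourhood in one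
fixed chart, whereas `hor` at $w$ uses the trivialization centred at the foot of $w$. The bridge is
`coord_cov`: in any trivialization $\nabla$ is $d+\Gamma$ with $\Gamma$ tensorial. Differentiability
of $\Gamma$ at the centre of the chart (`differentiableAt_christoffel`) then reduces the brackets to
calculus in $E\times E$, and the derivative and quadratic terms in $\Gamma$ assemble into $R$
(`curvature_eq_christoffel`). -/

noncomputable section

namespace LiftGeometry

/-! ### Local frames, and the connection as $d+\Gamma$ in a trivialization. -/

section Frame

variable {E : Type*} [NormedAddCommGroup E] [NormedSpace ℝ E]
  {M : Type*} [TopologicalSpace M] [ChartedSpace E M] [IsManifold 𝓘(ℝ, E) ∞ M]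

/-- The coordinates of tangent vectors at `q` in the preferred trivialization at `p`. -/
def coord (p q : M) : TangentSpace 𝓘(ℝ, E) q →L[ℝ] E :=
  (trivializationAt E (TangentSpace 𝓘(ℝ, E)) p).continuousLinearMapAt ℝ q

/-- The vector field which is constant, equal to `y`, in the preferred trivialization at `p`. -/
def frame (p : M) (y : E) (q : M) : TangentSpace 𝓘(ℝ, E) q :=
  (trivializationAt E (TangentSpace 𝓘(ℝ, E)) p).symmL ℝ q y

theorem coord_frame {p q : M} (hq : q ∈ (chartAt E p).source) (y : E) :
    coord p q (frame p y q) = y :=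
  (trivializationAt E (TangentSpace 𝓘(ℝ, E)) p).continuousLinearMapAt_symmL hq y

theorem frame_coord {p q : M} (hq : q ∈ (chartAt E p).source) (v : TangentSpace 𝓘(ℝ, E) q) :
    frame p (coord p q v) q = v :=
  (trivializationAt E (TangentSpace 𝓘(ℝ, E)) p).symmL_continuousLinearMapAt hq v

theorem coord_eq_trivializationAt {p q : M} (hq : q ∈ (chartAt E p).source)
    (v : TangentSpace 𝓘(ℝ, E) q) :
    coord p q v = (trivializationAt E (TangentSpace 𝓘(ℝ, E)) p ⟨q, v⟩).2 :=
  (trivializationAt E (TangentSpace 𝓘(ℝ, E)) p).continuousLinearMapAt_apply_of_mem ℝ hq v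

/-- The link between the bundle side, where the connection lives, and the chart side, where Lie
brackets are computed. -/
theorem coord_eq_mfderiv {p q : M} (hq : q ∈ (chartAt E p).source) :
    coord p q = (mfderiv 𝓘(ℝ, E) 𝓘(ℝ, E) (extChartAt 𝓘(ℝ, E) p) q : _ →L[ℝ] E) :=
  TangentBundle.continuousLinearMapAt_trivializationAt hq

theorem coord_self (p : M) (v : TangentSpace 𝓘(ℝ, E) p) : coord (E := E) p p v = v := by
  rw [coord_eq_trivializationAt (mem_chart_source E p)]
  exact congrArg Prod.snd (triv_self ⟨p, v⟩)

theorem extend_eq_frame {p q : M} (hq : q ∈ (chartAt E p).source) (v : TangentSpace 𝓘(ℝ, E) p) :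
    extend E v q = frame (E := E) p v q := by
  have e : (trivializationAt E (TangentSpace 𝓘(ℝ, E)) p ⟨p, v⟩).2 = v :=
    congrArg Prod.snd (triv_self ⟨p, v⟩)
  rw [extend, e]
  exact ((trivializationAt E (TangentSpace 𝓘(ℝ, E)) p).symmL_apply (R := ℝ) hq _).symm

theorem mdifferentiableAt_iff_coord {p q : M} (hq : q ∈ (chartAt E p).source)
    (s : ∀ q : M, TangentSpace 𝓘(ℝ, E) q) :
    MDifferentiableAt 𝓘(ℝ, E) 𝓘(ℝ, E).tangent
      (fun q => (⟨q, s q⟩ : TangentBundle 𝓘(ℝ, E) M)) q ↔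
    MDifferentiableAt 𝓘(ℝ, E) 𝓘(ℝ, E) (fun q => coord p q (s q)) q := by
  refine ((trivializationAt E (TangentSpace 𝓘(ℝ, E)) p).mdifferentiableAt_section_iff
    𝓘(ℝ, E) s hq).trans ?_
  refine Filter.EventuallyEq.mdifferentiableAt_iff ?_
  filter_upwards [(chartAt E p).open_source.mem_nhds hq] with x hx
  exact (coord_eq_trivializationAt hx (s x)).symm

theorem coord_frame_eventually {p q : M} (hq : q ∈ (chartAt E p).source) (y : E) :
    (fun q => coord p q (frame p y q)) =ᶠ[nhds q] fun _ => y := by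
  filter_upwards [(chartAt E p).open_source.mem_nhds hq] with x hx
  exact coord_frame hx y

theorem mdifferentiableAt_frame {p q : M} (hq : q ∈ (chartAt E p).source) (y : E) :
    MDifferentiableAt 𝓘(ℝ, E) 𝓘(ℝ, E).tangent
      (fun q => (⟨q, frame p y q⟩ : TangentBundle 𝓘(ℝ, E) M)) q :=
  (mdifferentiableAt_iff_coord hq _).2
    (mdifferentiableAt_const.congr_of_eventuallyEq (coord_frame_eventually hq y))

variable (cov : Connection E M)

theorem mdifferentiableAt_extend_of_mem {p q : M} (hq : q ∈ (chartAt E p).source)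
    (v : TangentSpace 𝓘(ℝ, E) p) :
    MDifferentiableAt 𝓘(ℝ, E) 𝓘(ℝ, E).tangent
      (fun q => (⟨q, extend E v q⟩ : TangentBundle 𝓘(ℝ, E) M)) q := by
  refine (mdifferentiableAt_frame hq (v : E)).congr_of_eventuallyEq ?_
  filter_upwards [(chartAt E p).open_source.mem_nhds hq] with x hx
  rw [extend_eq_frame hx]

/-- A covariant derivative depends only on the germ of the section, and the two fields agree on the
chart domain. -/
theorem cov_extend_eq {p q : M} (hq : q ∈ (chartAt E p).source) (v : TangentSpace 𝓘(ℝ, E) p) :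
    cov (extend E v) q = cov (frame (E := E) p v) q := by
  refine cov.isCovariantDerivativeOnUniv.congr_of_eventuallyEq
    (mdifferentiableAt_extend_of_mem hq v) (mdifferentiableAt_frame hq _) Filter.univ_mem ?_
  filter_upwards [(chartAt E p).open_source.mem_nhds hq] with x hx
  rw [extend_eq_frame hx]

/-- The connection and the flat derivative of the trivialization obey the same Leibniz rule, so the
terms $df(h)\,s$ cancel in their difference. -/
theorem tensorialAt_coord_cov {p q : M} (hq : q ∈ (chartAt E p).source)
    (h : TangentSpace 𝓘(ℝ, E) q) :
    TensorialAt 𝓘(ℝ, E) E (fun s : ∀ q : M, TangentSpace 𝓘(ℝ, E) q =>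
      coord p q (cov s q h) - mvfderiv 𝓘(ℝ, E) (fun q => coord p q (s q)) q h) q where
  smul {f s} hf hs := by
    have h1 : (fun q => coord p q ((f • s) q)) = f • fun q => coord p q (s q) := by
      funext x; exact (coord p x).map_smul (f x) (s x)
    rw [h1, mvfderiv_smul hf ((mdifferentiableAt_iff_coord hq s).1 hs),
      cov.isCovariantDerivativeOnUniv.leibniz hs hf]
    simp only [add_apply, smul_apply,
      ContinuousLinearMap.smulRight_apply, map_add, map_smul]
    module
  add {s s'} hs hs' := by
    have h1 : (fun q => coord p q ((s + s') q)) =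
        (fun q => coord p q (s q)) + fun q => coord p q (s' q) := by
      funext x; exact (coord p x).map_add (s x) (s' x)
    rw [h1, mvfderiv_add ((mdifferentiableAt_iff_coord hq s).1 hs)
      ((mdifferentiableAt_iff_coord hq s').1 hs'),
      cov.isCovariantDerivativeOnUniv.add hs hs']
    simp only [add_apply, map_add]
    abel

/-- `∇_h s = ds(h) + Γ(h, s)` in the preferred trivialization at `p`. -/
theorem coord_cov [FiniteDimensional ℝ E] {p q : M} (hq : q ∈ (chartAt E p).source)
    {s : ∀ q : M, TangentSpace 𝓘(ℝ, E) q}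
    (hs : MDifferentiableAt 𝓘(ℝ, E) 𝓘(ℝ, E).tangent
      (fun q => (⟨q, s q⟩ : TangentBundle 𝓘(ℝ, E) M)) q)
    (h : TangentSpace 𝓘(ℝ, E) q) :
    coord p q (cov s q h) = mvfderiv 𝓘(ℝ, E) (fun q => coord p q (s q)) q h
      + coord p q (cov (frame p (coord p q (s q))) q h) := by
  -- By tensoriality `s` may be replaced by the constant-coefficient field with the same value at
  -- `q`; its flat derivative is zero, so only the Christoffel term survives.
  have h1 := (tensorialAt_coord_cov cov hq h).pointwise hs
    (mdifferentiableAt_frame hq (coord p q (s q))) (frame_coord hq (s q)).symm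
  have h2 : mvfderiv 𝓘(ℝ, E) (fun x => coord p x (frame p (coord p q (s q)) x)) q = 0 := by
    have := (coord_frame_eventually hq (coord p q (s q))).mfderiv_eq (I := 𝓘(ℝ, E)) (I' := 𝓘(ℝ, E))
    ext v
    have h3 := congrArg (fun T => (T v : E)) this
    refine h3.trans ?_
    rw [mfderiv_const]; rfl
  rw [h2] at h1
  simp only [zero_apply, sub_zero] at h1
  exact sub_eq_iff_eq_add'.1 h1

end Frame

/-! ### Christoffel symbols and their differentiability. -/

section Christoffel

variable {E : Type*} [NormedAddCommGroup E] [NormedSpace ℝ E]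
  {M : Type*} [TopologicalSpace M] [ChartedSpace E M] [IsManifold 𝓘(ℝ, E) ∞ M]
variable (cov : Connection E M)

/-- The Christoffel form `a ↦ Γ(a, y)` of a connection in the preferred trivialization at `p`. -/
def christoffelForm (p : M) (y : E) (q : M) : E →L[ℝ] E :=
  coord p q ∘L cov (frame p y) q ∘L
    (trivializationAt E (TangentSpace 𝓘(ℝ, E)) p).symmL ℝ q

theorem contMDiffOn_frame (p : M) (y : E) :
    ContMDiffOn 𝓘(ℝ, E) 𝓘(ℝ, E).tangent ∞
      (fun q => (⟨q, frame p y q⟩ : TangentBundle 𝓘(ℝ, E) M)) (chartAt E p).source := by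
  intro q hq
  refine ContMDiffAt.contMDiffWithinAt ?_
  refine ((trivializationAt E (TangentSpace 𝓘(ℝ, E)) p).contMDiffAt_section_iff hq).2 ?_
  refine (contMDiffAt_const (c := y)).congr_of_eventuallyEq ?_
  filter_upwards [(chartAt E p).open_source.mem_nhds hq] with x hx
  rw [← coord_eq_trivializationAt hx, coord_frame hx]

/-- A smooth vector field on `M` which agrees with `frame p y` near `p`. -/
theorem exists_smoothField_eq_frame [FiniteDimensional ℝ E] [T2Space M] (p : M) (y : E) :
    ∃ s : ∀ q : M, TangentSpace 𝓘(ℝ, E) q,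
      SmoothField s ∧ ∀ᶠ q in nhds p, s q = frame p y q := by
  let f : SmoothBumpFunction 𝓘(ℝ, E) p := Classical.arbitrary _
  refine ⟨fun q => f q • frame p y q, ?_, ?_⟩
  · intro q
    by_cases hq : q ∈ tsupport f
    · have hq' := f.tsupport_subset_chartAt_source hq
      exact f.contMDiffAt.smul_section
        ((contMDiffOn_frame p y).contMDiffAt ((chartAt E p).open_source.mem_nhds hq'))
    -- Off the closed support of the bump function the field is locally the zero section, whatever
    -- `frame` does outside its chart.
    · have h0 := contMDiffAt_zeroSection (n := ∞) (IB := 𝓘(ℝ, E)) ℝ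
        (E := fun q : M => TangentSpace 𝓘(ℝ, E) q) (F := E) (x := q)
      refine h0.congr_of_eventuallyEq ?_
      filter_upwards [(isClosed_tsupport f).isOpen_compl.mem_nhds hq] with x hx
      have : f x = 0 := image_eq_zero_of_notMem_tsupport hx
      simp only [this, zero_smul]
      rfl
  · filter_upwards [f.eventuallyEq_one] with x hx
    rw [hx]
    exact one_smul ℝ (frame p y x)

/-- Smoothness of the connection is applied to a globally smooth field; the cut-off frame is one,
and it has the same germ as the frame at `p`. -/
theorem mdifferentiableAt_christoffelForm [FiniteDimensional ℝ E] [T2Space M]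
    [CovariantDerivative.ContMDiffCovariantDerivative cov ∞] (p : M) (y : E) :
    MDifferentiableAt 𝓘(ℝ, E) 𝓘(ℝ, E →L[ℝ] E) (christoffelForm cov p y) p := by
  obtain ⟨s, hs, hsy⟩ := exists_smoothField_eq_frame p y
  have h1 := (CovariantDerivative.ContMDiffCovariantDerivative.contMDiff (cov := cov)
    (k := ∞)).contMDiff (σ := s) (by exact hs.contMDiffOn)
  have h2 := (contMDiffAt_hom_bundle _).1 (contMDiffOn_univ.1 h1 p)
  refine (h2.2.mdifferentiableAt (by simp)).congr_of_eventuallyEq ?_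
  filter_upwards [(chartAt E p).open_source.mem_nhds (mem_chart_source E p),
    eventually_eventually_nhds.2 hsy] with q hq hq'
  have h3 : cov s q = cov (frame p y) q :=
    cov.isCovariantDerivativeOnUniv.congr_of_eventuallyEq
      ((hs q).mdifferentiableAt (by simp)) (mdifferentiableAt_frame hq y) Filter.univ_mem hq'
  rw [christoffelForm, ← h3]
  rfl

theorem coord_cov_frame_linear {p q : M} (hq : q ∈ (chartAt E p).source) :
    ∃ f : E →ₗ[ℝ] (TangentSpace 𝓘(ℝ, E) q →L[ℝ] TangentSpace 𝓘(ℝ, E) q),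
      ∀ y, f y = cov (frame p y) q := by
  refine ⟨{ toFun := fun y => cov (frame p y) q, map_add' := ?_, map_smul' := ?_ }, fun _ => rfl⟩
  · intro y z
    have : frame p (y + z) = frame p y + frame p z := by
      funext x; exact map_add _ y z
    rw [this]
    exact cov.isCovariantDerivativeOnUniv.add (mdifferentiableAt_frame hq y)
      (mdifferentiableAt_frame hq z)
  · intro c y
    have : frame p (c • y) = c • frame p y := by
      funext x; exact map_smul _ c y
    rw [this]
    exact cov.isCovariantDerivativeOnUniv.smul_const c (mdifferentiableAt_frame hq y)

/-- The Christoffel symbol `Γ(y, a)` of a connection as a function on the model space. -/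
def christoffel [FiniteDimensional ℝ E] (p : M) (x : E) : E →L[ℝ] E →L[ℝ] E :=
  -- Expanding `y` in a basis makes the symbol continuous and linear in `y` at every `x` and reduces
  -- its differentiability to finitely many forms. The first vector argument is the section value,
  -- the second the direction. The values carry geometric meaning only over the chart.
  ∑ i, ((Module.finBasis ℝ E).coord i).toContinuousLinearMap.smulRight
    (christoffelForm cov p (Module.finBasis ℝ E i) ((extChartAt 𝓘(ℝ, E) p).symm x))

theorem christoffel_apply [FiniteDimensional ℝ E] {p q : M} (hq : q ∈ (chartAt E p).source)
    (y : E) (v : TangentSpace 𝓘(ℝ, E) q) :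
    christoffel cov p (extChartAt 𝓘(ℝ, E) p q) y (coord p q v)
      = coord p q (cov (frame p y) q v) := by
  obtain ⟨f, hf⟩ := coord_cov_frame_linear cov hq
  have hq' : (extChartAt 𝓘(ℝ, E) p).symm (extChartAt 𝓘(ℝ, E) p q) = q :=
    (extChartAt 𝓘(ℝ, E) p).left_inv (by rwa [extChartAt_source])
  have h1 : f y = ∑ i, (Module.finBasis ℝ E).coord i y • f (Module.finBasis ℝ E i) := by
    conv_lhs => rw [← (Module.finBasis ℝ E).sum_repr y, map_sum]
    simp only [map_smul, Module.Basis.coord_apply]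
  rw [← hf, h1]
  simp only [christoffel, hq', sum_apply, map_sum,
    ContinuousLinearMap.smulRight_apply, smul_apply, map_smul]
  refine Finset.sum_congr rfl fun i _ => ?_
  rw [hf]
  exact congrArg (fun w => _ • coord p q (cov _ q w)) (frame_coord hq v)

/-- The manifold derivative at `p` is by definition the derivative read in the chart at `p`, here
without boundary. -/
theorem hasFDerivAt_comp_extChartAt_symm {F : Type*} [NormedAddCommGroup F] [NormedSpace ℝ F]
    {p : M} {g : M → F} (hg : MDifferentiableAt 𝓘(ℝ, E) 𝓘(ℝ, F) g p) :
    HasFDerivAt (fun x => g ((extChartAt 𝓘(ℝ, E) p).symm x))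
      (mvfderiv 𝓘(ℝ, E) g p : E →L[ℝ] F) (extChartAt 𝓘(ℝ, E) p p) := by
  have h1 := hg.hasMFDerivAt.2
  simp only [modelWithCornersSelf_coe, Set.range_id] at h1
  exact hasFDerivWithinAt_univ.1 h1

set_option synthInstance.maxHeartbeats 200000 in
theorem differentiableAt_christoffel [FiniteDimensional ℝ E] [T2Space M]
    [CovariantDerivative.ContMDiffCovariantDerivative cov ∞] (p : M) :
    DifferentiableAt ℝ (christoffel cov p) (extChartAt 𝓘(ℝ, E) p p) := by
  have key (i : Fin (Module.finrank ℝ E)) : DifferentiableAt ℝ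
      (fun x : E => (((Module.finBasis ℝ E).coord i).toContinuousLinearMap.smulRight
        (christoffelForm cov p (Module.finBasis ℝ E i) ((extChartAt 𝓘(ℝ, E) p).symm x)) :
          E →L[ℝ] E →L[ℝ] E)) (extChartAt 𝓘(ℝ, E) p p) := by
    have h := (hasFDerivAt_comp_extChartAt_symm
      (mdifferentiableAt_christoffelForm cov p (Module.finBasis ℝ E i))).differentiableAt
    let c : (E →L[ℝ] E) →L[ℝ] E →L[ℝ] E →L[ℝ] E :=
      ContinuousLinearMap.smulRightL ℝ E (E →L[ℝ] E)
        (((Module.finBasis ℝ E).coord i).toContinuousLinearMap : E →L[ℝ] ℝ)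
    exact DifferentiableAt.comp (𝕜 := ℝ) (E := E) (F := E →L[ℝ] E) (G := E →L[ℝ] E →L[ℝ] E)
      (extChartAt 𝓘(ℝ, E) p p) c.differentiableAt h
  exact DifferentiableAt.fun_sum (𝕜 := ℝ) (E := E) (F := E →L[ℝ] E →L[ℝ] E) (u := Finset.univ)
    fun i _ => key i

end Christoffel

/-! ### Lie brackets and lifts read in a fixed chart. -/

section Chart

section General

variable {F : Type*} [NormedAddCommGroup F] [NormedSpace ℝ F]
  {G : Type*} [NormedAddCommGroup G] [NormedSpace ℝ G]
  {G' : Type*} [NormedAddCommGroup G'] [NormedSpace ℝ G']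
  {H : Type*} [TopologicalSpace H] {I : ModelWithCorners ℝ F H}
  {N : Type*} [TopologicalSpace N] [ChartedSpace H N]

theorem mvfderiv_prodMk {f : N → G} {g : N → G'} {x : N}
    (hf : MDifferentiableAt I 𝓘(ℝ, G) f x) (hg : MDifferentiableAt I 𝓘(ℝ, G') g x)
    (v : TangentSpace I x) :
    mvfderiv I (fun x => (f x, g x)) x v = (mvfderiv I f x v, mvfderiv I g x v) := by
  have hfg := hf.prodMk_space hg
  have h := hf.hasMFDerivAt.2.prodMk hg.hasMFDerivAt.2
  have h' : HasMFDerivAt I 𝓘(ℝ, G × G') (fun x => (f x, g x)) x _ := ⟨hfg.continuousAt, h⟩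
  have := h'.mfderiv
  exact congrArg (fun T => (T v : G × G')) this

/-- The Lie bracket of vector fields, computed in the preferred chart. -/
theorem mlieBracket_eq_lieBracket [I.Boundaryless] [IsManifold I 1 N]
    {V W : ∀ x : N, TangentSpace I x} {V' W' : F → F} {x : N}
    (hV : (fun y => mvfderiv I (extChartAt I x) y (V y)) =ᶠ[nhds x] V' ∘ extChartAt I x)
    (hW : (fun y => mvfderiv I (extChartAt I x) y (W y)) =ᶠ[nhds x] W' ∘ extChartAt I x) :
    mlieBracket I V W x = lieBracket ℝ V' W' (extChartAt I x x) := by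
  have key {V : ∀ x : N, TangentSpace I x} {V' : F → F}
      (hV : (fun y => mvfderiv I (extChartAt I x) y (V y)) =ᶠ[nhds x] V' ∘ extChartAt I x) :
      mpullbackWithin 𝓘(ℝ, F) I (extChartAt I x).symm V (Set.range I)
        =ᶠ[nhds (extChartAt I x x)] V' := by
    have hc : Filter.Tendsto (extChartAt I x).symm (nhds (extChartAt I x x)) (nhds x) := by
      have := continuousAt_extChartAt_symm (I := I) x
      rwa [ContinuousAt, extChartAt_to_inv] at this
    filter_upwards [extChartAt_target_mem_nhds (I := I) x, hc.eventually hV] with z hz hz'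
    rw [Function.comp_apply, (extChartAt I x).right_inv hz] at hz'
    -- Pulling back along the inverse chart inverts its derivative, which gives back the derivative
    -- of the chart.
    rw [← hz', mpullbackWithin_apply, ContinuousLinearMap.inverse_eq
      (mfderivWithin_extChartAt_symm_comp_mfderiv_extChartAt hz)
      (mfderiv_extChartAt_comp_mfderivWithin_extChartAt_symm hz)]
    rfl
  -- At its own centre the preferred chart has identity derivative, so the bracket needs no
  -- transport back to the manifold.
  have hid (v : F) :
      ((mfderiv I 𝓘(ℝ, F) (extChartAt I x) x).inverse : F →L[ℝ] F) v = v := by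
    rw [mfderiv_extChartAt_self]
    exact congrArg (fun T : F →L[ℝ] F => T v) ContinuousLinearMap.inverse_id
  rw [← mlieBracketWithin_univ, mlieBracketWithin_apply]
  refine (hid _).trans ?_
  simp only [Set.preimage_univ, Set.univ_inter]
  rw [I.range_eq_univ]
  refine (congrFun (lieBracketWithin_univ (𝕜 := ℝ) (E := F)) _).trans ?_
  have h1 := key hV
  have h2 := key hW
  rw [I.range_eq_univ] at h1 h2
  exact h1.lieBracket_vectorField_eq h2

end General

variable {E : Type*} [NormedAddCommGroup E] [NormedSpace ℝ E]
  {M : Type*} [TopologicalSpace M] [ChartedSpace E M] [IsManifold 𝓘(ℝ, E) ∞ M]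

theorem extChartAt_tangent_eventually {u w : TangentBundle 𝓘(ℝ, E) M}
    (hw : w.1 ∈ (chartAt E u.1).source) :
    (extChartAt 𝓘(ℝ, E).tangent u : TangentBundle 𝓘(ℝ, E) M → E × E) =ᶠ[nhds w]
      fun w => (extChartAt 𝓘(ℝ, E) u.1 w.1, coord u.1 w.1 w.2) := by
  have : (fun w : TangentBundle 𝓘(ℝ, E) M => w.1) ⁻¹' (chartAt E u.1).source ∈ nhds w :=
    (FiberBundle.continuous_proj E (TangentSpace 𝓘(ℝ, E) : M → Type _)).continuousAt.preimage_mem_nhds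
      ((chartAt E u.1).open_source.mem_nhds hw)
  filter_upwards [this] with w' hw'
  refine Prod.ext rfl ?_
  exact (coord_eq_trivializationAt hw' w'.2).symm

theorem mdifferentiableAt_extChartAt_tangent {u w : TangentBundle 𝓘(ℝ, E) M}
    (hw : w.1 ∈ (chartAt E u.1).source) :
    MDifferentiableAt 𝓘(ℝ, E).tangent 𝓘(ℝ, E × E) (extChartAt 𝓘(ℝ, E).tangent u) w :=
  mdifferentiableAt_extChartAt ((TangentBundle.mem_chart_source_iff _ _).2 hw)

/-- The chart is linear on fibres, so the curve $t\mapsto w+tv$ remains an affine line with fixed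
base point, even when the chart is centred at another point `u`. -/
theorem mvfderiv_extChartAt_vert {u w : TangentBundle 𝓘(ℝ, E) M}
    (hw : w.1 ∈ (chartAt E u.1).source) (v : TangentSpace 𝓘(ℝ, E) w.1) :
    mvfderiv 𝓘(ℝ, E).tangent (extChartAt 𝓘(ℝ, E).tangent u) w (vert w v)
      = (0, coord u.1 w.1 v) := by
  have hψ := mdifferentiableAt_extChartAt_tangent hw
  let c : ℝ → TangentBundle 𝓘(ℝ, E) M := fun t => ⟨w.1, w.2 + t • v⟩
  have hc0 : c 0 = w := by
    have : w.2 + (0 : ℝ) • v = w.2 := by rw [zero_smul, add_zero]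
    exact congrArg (TotalSpace.mk w.1) this
  have hc : MDifferentiableAt 𝓘(ℝ, ℝ) 𝓘(ℝ, E).tangent c 0 := by
    refine (mdifferentiableAt_totalSpace _ c).2 ⟨mdifferentiableAt_const, ?_⟩
    have h (t : ℝ) : (trivializationAt E (TangentSpace 𝓘(ℝ, E)) w.1 (c t)).2 = w.2 + t • v :=
      congrArg Prod.snd (triv_self (c t))
    have h' : (fun t => (trivializationAt E (TangentSpace 𝓘(ℝ, E)) (c 0).1 (c t)).2) =
      fun t => (w.2 + t • v : E) := funext h
    rw [h']
    exact (line_contDiff (E := E) w.2 v).mdifferentiableAt one_ne_zero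
  have h1 := mfderiv_comp_apply_of_eq (x := (0 : ℝ)) hψ hc hc0 (1 : ℝ)
  refine h1.symm.trans ?_
  have h2 : (extChartAt 𝓘(ℝ, E).tangent u : TangentBundle 𝓘(ℝ, E) M → E × E) ∘ c =
      fun t : ℝ => (extChartAt 𝓘(ℝ, E) u.1 w.1, coord u.1 w.1 w.2 + t • coord u.1 w.1 v) := by
    funext t
    refine Prod.ext rfl ?_
    refine (coord_eq_trivializationAt hw (w.2 + t • v)).symm.trans ?_
    rw [map_add, map_smul]
  rw [h2, mfderiv_eq_fderiv]
  have h0 : HasDerivAt (fun t : ℝ => coord u.1 w.1 w.2 + t • coord u.1 w.1 v)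
      (coord u.1 w.1 v) 0 := by
    simpa using ((hasDerivAt_id (0 : ℝ)).smul_const (coord u.1 w.1 v)).const_add
      (coord u.1 w.1 w.2)
  have h3 : HasDerivAt (fun t : ℝ => (extChartAt 𝓘(ℝ, E) u.1 w.1,
      coord u.1 w.1 w.2 + t • coord u.1 w.1 v)) ((0 : E), coord u.1 w.1 v) 0 :=
    (hasDerivAt_const _ _).prodMk h0
  exact h3.deriv

variable (cov : Connection E M)

/-- The horizontal lift is built from an extension adapted to `w`, but the chart is centred at `u`.
The flat derivative of that extension occurs both in $ds(h)$ and in $\nabla_hs$ and cancels, leaving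
only the Christoffel term of the chart. -/
theorem mvfderiv_extChartAt_hor [FiniteDimensional ℝ E] {u w : TangentBundle 𝓘(ℝ, E) M}
    (hw : w.1 ∈ (chartAt E u.1).source) (h : TangentSpace 𝓘(ℝ, E) w.1) :
    mvfderiv 𝓘(ℝ, E).tangent (extChartAt 𝓘(ℝ, E).tangent u) w (hor cov w h)
      = (coord u.1 w.1 h, -coord u.1 w.1 (cov (frame u.1 (coord u.1 w.1 w.2)) w.1 h)) := by
  have hψ := mdifferentiableAt_extChartAt_tangent hw
  let s : M → TangentBundle 𝓘(ℝ, E) M := fun q => ⟨q, extend E w.2 q⟩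
  have hs : MDifferentiableAt 𝓘(ℝ, E) 𝓘(ℝ, E).tangent s w.1 := mdifferentiableAt_extend ..
  have hs0 : s w.1 = w := congrArg (TotalSpace.mk w.1) (extend_apply_self E w.2)
  have h1 := mfderiv_comp_apply_of_eq (x := w.1) hψ hs hs0 h
  have h2 : (extChartAt 𝓘(ℝ, E).tangent u : TangentBundle 𝓘(ℝ, E) M → E × E) ∘ s =ᶠ[nhds w.1]
      fun q => (extChartAt 𝓘(ℝ, E) u.1 q, coord u.1 q (extend E w.2 q)) := by
    filter_upwards [(chartAt E u.1).open_source.mem_nhds hw] with q hq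
    exact (extChartAt_tangent_eventually (u := u) (w := s q) hq).self_of_nhds
  have h3 := mvfderiv_prodMk (mdifferentiableAt_extChartAt hw)
    ((mdifferentiableAt_iff_coord hw _).1 hs) h
  have h4 : (mfderiv 𝓘(ℝ, E).tangent 𝓘(ℝ, E × E) (extChartAt 𝓘(ℝ, E).tangent u) w
      (mfderiv 𝓘(ℝ, E) 𝓘(ℝ, E).tangent s w.1 h) : E × E) =
      (coord u.1 w.1 h, mvfderiv 𝓘(ℝ, E) (fun q => coord u.1 q (extend E w.2 q)) w.1 h) := by
    refine h1.symm.trans ?_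
    have h5 := h2.mfderiv_eq (I := 𝓘(ℝ, E)) (I' := 𝓘(ℝ, E × E))
    refine (congrArg (fun T => (T h : E × E)) h5).trans (h3.trans ?_)
    rw [coord_eq_mfderiv hw]
    rfl
  have h6 := coord_cov cov hw hs h
  have h7 := mvfderiv_extChartAt_vert hw (cov (extend E w.2) w.1 h)
  let a : TangentSpace 𝓘(ℝ, E).tangent w := mfderiv 𝓘(ℝ, E) 𝓘(ℝ, E).tangent s w.1 h
  have h8 := map_sub (mvfderiv 𝓘(ℝ, E).tangent (extChartAt 𝓘(ℝ, E).tangent u) w)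
    a (vert w (cov (extend E w.2) w.1 h))
  refine h8.trans ((congrArg₂ (fun x y : E × E => x - y) h4 h7).trans ?_)
  rw [h6, extend_apply_self]
  refine Prod.ext (sub_zero _) ?_
  exact sub_add_cancel_left _ _

end Chart

/-! ### The three brackets of lifts. -/

section Bracket

section Calculus

variable {E : Type*} [NormedAddCommGroup E] [NormedSpace ℝ E]
  {X Y : E → E} {X' Y' : E →L[ℝ] E} {Γ : E → E →L[ℝ] E →L[ℝ] E}
  {Γ' : E →L[ℝ] E →L[ℝ] E →L[ℝ] E} {x : E}

set_option synthInstance.maxHeartbeats 200000 in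
theorem fderiv_horizontal (hX : HasFDerivAt X X' x) (hΓ : HasFDerivAt Γ Γ' x) (u a b : E) :
    fderiv ℝ (fun z : E × E => (X z.1, -Γ z.1 z.2 (X z.1))) (x, u) (a, b)
      = (X' a, -(Γ' a u (X x) + Γ x b (X x) + Γ x u (X' a))) := by
  have h1 : HasFDerivAt (fun z : E × E => X z.1) (X' ∘L ContinuousLinearMap.fst ℝ E E) (x, u) :=
    HasFDerivAt.comp (x, u) (f := Prod.fst) hX hasFDerivAt_fst
  have h2 : HasFDerivAt (fun z : E × E => Γ z.1) (Γ' ∘L ContinuousLinearMap.fst ℝ E E) (x, u) :=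
    HasFDerivAt.comp (𝕜 := ℝ) (E := E × E) (F := E) (G := E →L[ℝ] E →L[ℝ] E) (x, u)
      (f := Prod.fst) hΓ hasFDerivAt_fst
  have h3 : HasFDerivAt (fun z : E × E => z.2) (ContinuousLinearMap.snd ℝ E E) (x, u) :=
    hasFDerivAt_snd
  have h4 : HasFDerivAt (fun z : E × E => (X z.1, -Γ z.1 z.2 (X z.1))) _ (x, u) :=
    h1.prodMk ((h2.clm_apply h3).clm_apply h1).neg
  rw [h4.fderiv]
  refine Prod.ext rfl ?_
  simp
  abel

set_option synthInstance.maxHeartbeats 200000 in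
theorem hasFDerivAt_apply_apply (hΓ : HasFDerivAt Γ Γ' x) (u v : E) :
    HasFDerivAt (fun x => Γ x u v) ((Γ'.flip u).flip v) x := by
  have h := (hΓ.clm_apply (hasFDerivAt_const u x)).clm_apply (hasFDerivAt_const v x)
  refine h.congr_fderiv ?_
  ext a
  simp

theorem fderiv_vertical (hY : HasFDerivAt Y Y' x) (u a b : E) :
    fderiv ℝ (fun z : E × E => ((0 : E), Y z.1)) (x, u) (a, b) = (0, Y' a) := by
  have h1 : HasFDerivAt (fun z : E × E => Y z.1) (Y' ∘L ContinuousLinearMap.fst ℝ E E) (x, u) :=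
    HasFDerivAt.comp (x, u) (f := Prod.fst) hY hasFDerivAt_fst
  rw [((hasFDerivAt_const (0 : E) _).prodMk h1).fderiv]
  rfl

theorem lieBracket_const (a b x : E) :
    lieBracket ℝ (fun _ : E => a) (fun _ : E => b) x = 0 := by
  simp [lieBracket]

theorem lieBracket_vertical_vertical (hX : HasFDerivAt X X' x) (hY : HasFDerivAt Y Y' x) (u : E) :
    lieBracket ℝ (fun z : E × E => ((0 : E), X z.1)) (fun z => (0, Y z.1)) (x, u) = 0 := by
  rw [lieBracket, fderiv_vertical hX, fderiv_vertical hY]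
  simp

-- The Christoffel term comes from differentiating $-\Gamma_x(u,X)$ along the fibre in the direction
-- of $Y$.
set_option synthInstance.maxHeartbeats 200000 in
theorem lieBracket_horizontal_vertical (hX : HasFDerivAt X X' x) (hY : HasFDerivAt Y Y' x)
    (hΓ : HasFDerivAt Γ Γ' x) (u : E) :
    lieBracket ℝ (fun z : E × E => (X z.1, -Γ z.1 z.2 (X z.1))) (fun z => (0, Y z.1)) (x, u)
      = (0, Y' (X x) + Γ x (Y x) (X x)) := by
  rw [lieBracket, fderiv_horizontal hX hΓ, fderiv_vertical hY]
  simp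

-- Base derivatives of $\Gamma$ give the $\Gamma'$ terms, fibre derivatives along
-- $-\Gamma_x(u,\cdot)$ give the quadratic ones, and derivatives of the fields collect into
-- $-\Gamma_x(u,[X,Y])$.
set_option synthInstance.maxHeartbeats 200000 in
theorem lieBracket_horizontal_horizontal (hX : HasFDerivAt X X' x) (hY : HasFDerivAt Y Y' x)
    (hΓ : HasFDerivAt Γ Γ' x) (u : E) :
    lieBracket ℝ (fun z : E × E => (X z.1, -Γ z.1 z.2 (X z.1)))
        (fun z => (Y z.1, -Γ z.1 z.2 (Y z.1))) (x, u)
      = (lieBracket ℝ X Y x, -Γ x u (lieBracket ℝ X Y x)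
          - (Γ' (X x) u (Y x) + Γ x (Γ x u (Y x)) (X x)
            - (Γ' (Y x) u (X x) + Γ x (Γ x u (X x)) (Y x)))) := by
  rw [lieBracket, fderiv_horizontal hX hΓ, fderiv_horizontal hY hΓ, lieBracket, hX.fderiv,
    hY.fderiv]
  refine Prod.ext rfl ?_
  simp
  abel

end Calculus

variable {E : Type*} [NormedAddCommGroup E] [NormedSpace ℝ E]
  {M : Type*} [TopologicalSpace M] [ChartedSpace E M] [IsManifold 𝓘(ℝ, E) ∞ M]

/-- The vector field `X` in the preferred chart at `p`. -/
def localRep (p : M) (X : ∀ q : M, TangentSpace 𝓘(ℝ, E) q) (x : E) : E :=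
  coord p ((extChartAt 𝓘(ℝ, E) p).symm x) (X ((extChartAt 𝓘(ℝ, E) p).symm x))

theorem localRep_apply {p q : M} (hq : q ∈ (chartAt E p).source)
    (X : ∀ q : M, TangentSpace 𝓘(ℝ, E) q) :
    localRep p X (extChartAt 𝓘(ℝ, E) p q) = coord p q (X q) := by
  rw [localRep, (extChartAt 𝓘(ℝ, E) p).left_inv (by rwa [extChartAt_source])]

theorem localRep_self (p : M) (X : ∀ q : M, TangentSpace 𝓘(ℝ, E) q) :
    localRep p X (extChartAt 𝓘(ℝ, E) p p) = X p :=
  (localRep_apply (mem_chart_source E p) X).trans (coord_self p (X p))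

theorem hasFDerivAt_localRep {p : M} {X : ∀ q : M, TangentSpace 𝓘(ℝ, E) q}
    (hX : MDifferentiableAt 𝓘(ℝ, E) 𝓘(ℝ, E).tangent
      (fun q => (⟨q, X q⟩ : TangentBundle 𝓘(ℝ, E) M)) p) :
    HasFDerivAt (localRep p X) (mvfderiv 𝓘(ℝ, E) (fun q => coord p q (X q)) p : E →L[ℝ] E)
      (extChartAt 𝓘(ℝ, E) p p) :=
  hasFDerivAt_comp_extChartAt_symm
    ((mdifferentiableAt_iff_coord (mem_chart_source E p) X).1 hX)

theorem mlieBracket_eq_lieBracket_localRep (p : M) (X Y : ∀ q : M, TangentSpace 𝓘(ℝ, E) q) :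
    mlieBracket 𝓘(ℝ, E) X Y p
      = lieBracket ℝ (localRep p X) (localRep p Y) (extChartAt 𝓘(ℝ, E) p p) := by
  have key (X : ∀ q : M, TangentSpace 𝓘(ℝ, E) q) :
      (fun q => mvfderiv 𝓘(ℝ, E) (extChartAt 𝓘(ℝ, E) p) q (X q))
        =ᶠ[nhds p] localRep p X ∘ extChartAt 𝓘(ℝ, E) p := by
    filter_upwards [(chartAt E p).open_source.mem_nhds (mem_chart_source E p)] with q hq
    rw [Function.comp_apply, localRep_apply hq, coord_eq_mfderiv hq]
    rfl
  exact mlieBracket_eq_lieBracket (key X) (key Y)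

section Lifts

theorem eventually_proj_mem (w : TangentBundle 𝓘(ℝ, E) M) :
    ∀ᶠ w' : TangentBundle 𝓘(ℝ, E) M in nhds w, w'.1 ∈ (chartAt E w.1).source :=
  (FiberBundle.continuous_proj E (TangentSpace 𝓘(ℝ, E) : M → Type _)).continuousAt.preimage_mem_nhds
    ((chartAt E w.1).open_source.mem_nhds (mem_chart_source E w.1))

theorem extChartAt_tangent_apply {u w : TangentBundle 𝓘(ℝ, E) M}
    (hw : w.1 ∈ (chartAt E u.1).source) :
    extChartAt 𝓘(ℝ, E).tangent u w = (extChartAt 𝓘(ℝ, E) u.1 w.1, coord u.1 w.1 w.2) :=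
  (extChartAt_tangent_eventually hw).self_of_nhds

theorem extChartAt_tangent_self (w : TangentBundle 𝓘(ℝ, E) M) :
    extChartAt 𝓘(ℝ, E).tangent w w = (extChartAt 𝓘(ℝ, E) w.1 w.1, (w.2 : E)) :=
  (extChartAt_tangent_apply (mem_chart_source E w.1)).trans
    (congrArg (Prod.mk _) (coord_self w.1 w.2))

theorem mvfderiv_extChartAt_vertLift (w : TangentBundle 𝓘(ℝ, E) M)
    (X : ∀ q : M, TangentSpace 𝓘(ℝ, E) q) :
    (fun w' => mvfderiv 𝓘(ℝ, E).tangent (extChartAt 𝓘(ℝ, E).tangent w) w' (vertLift X w'))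
      =ᶠ[nhds w] (fun z : E × E => ((0 : E), localRep w.1 X z.1)) ∘
        extChartAt 𝓘(ℝ, E).tangent w := by
  filter_upwards [eventually_proj_mem w] with w' hw'
  rw [Function.comp_apply, extChartAt_tangent_apply hw']
  refine (mvfderiv_extChartAt_vert hw' (X w'.1)).trans ?_
  dsimp only
  rw [localRep_apply hw']

variable [FiniteDimensional ℝ E] (cov : Connection E M)

theorem mvfderiv_extChartAt_horLift (w : TangentBundle 𝓘(ℝ, E) M)
    (X : ∀ q : M, TangentSpace 𝓘(ℝ, E) q) :
    (fun w' => mvfderiv 𝓘(ℝ, E).tangent (extChartAt 𝓘(ℝ, E).tangent w) w' (horLift cov X w'))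
      =ᶠ[nhds w] (fun z : E × E => (localRep w.1 X z.1,
            -christoffel cov w.1 z.1 z.2 (localRep w.1 X z.1))) ∘
          extChartAt 𝓘(ℝ, E).tangent w := by
  filter_upwards [eventually_proj_mem w] with w' hw'
  rw [Function.comp_apply, extChartAt_tangent_apply hw']
  refine (mvfderiv_extChartAt_hor cov hw' (X w'.1)).trans ?_
  dsimp only
  rw [localRep_apply hw', christoffel_apply cov hw']

theorem christoffel_self (p : M) (y : E) (v : TangentSpace 𝓘(ℝ, E) p) :
    christoffel cov p (extChartAt 𝓘(ℝ, E) p p) y v = cov (frame p y) p v := by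
  have h := christoffel_apply cov (mem_chart_source E p) y v
  rw [coord_self, coord_self] at h
  exact h

theorem cov_eq_christoffel {p : M} {s : ∀ q : M, TangentSpace 𝓘(ℝ, E) q}
    (hs : MDifferentiableAt 𝓘(ℝ, E) 𝓘(ℝ, E).tangent
      (fun q => (⟨q, s q⟩ : TangentBundle 𝓘(ℝ, E) M)) p)
    (h : TangentSpace 𝓘(ℝ, E) p) :
    (cov s p h : E) = mvfderiv 𝓘(ℝ, E) (fun q => coord p q (s q)) p h
      + christoffel cov p (extChartAt 𝓘(ℝ, E) p p) (s p) h := by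
  have h1 := coord_cov cov (mem_chart_source E p) hs h
  rw [coord_self, coord_self, coord_self] at h1
  exact h1.trans (congrArg (_ + ·) (christoffel_self cov p (s p) h).symm)

variable {X Y : ∀ q : M, TangentSpace 𝓘(ℝ, E) q} {w : TangentBundle 𝓘(ℝ, E) M}

theorem mlieBracket_vertLift_vertLift
    (hX : MDifferentiableAt 𝓘(ℝ, E) 𝓘(ℝ, E).tangent
      (fun q => (⟨q, X q⟩ : TangentBundle 𝓘(ℝ, E) M)) w.1)
    (hY : MDifferentiableAt 𝓘(ℝ, E) 𝓘(ℝ, E).tangent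
      (fun q => (⟨q, Y q⟩ : TangentBundle 𝓘(ℝ, E) M)) w.1) :
    mlieBracket 𝓘(ℝ, E).tangent (vertLift X) (vertLift Y) w = 0 := by
  refine (mlieBracket_eq_lieBracket (mvfderiv_extChartAt_vertLift w X)
    (mvfderiv_extChartAt_vertLift w Y)).trans ?_
  rw [extChartAt_tangent_self]
  exact lieBracket_vertical_vertical (hasFDerivAt_localRep hX) (hasFDerivAt_localRep hY) w.2

variable [T2Space M] [CovariantDerivative.ContMDiffCovariantDerivative cov ∞]

theorem mlieBracket_horLift_vertLift
    (hX : MDifferentiableAt 𝓘(ℝ, E) 𝓘(ℝ, E).tangent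
      (fun q => (⟨q, X q⟩ : TangentBundle 𝓘(ℝ, E) M)) w.1)
    (hY : MDifferentiableAt 𝓘(ℝ, E) 𝓘(ℝ, E).tangent
      (fun q => (⟨q, Y q⟩ : TangentBundle 𝓘(ℝ, E) M)) w.1) :
    mlieBracket 𝓘(ℝ, E).tangent (horLift cov X) (vertLift Y) w
      = vert w (cov Y w.1 (X w.1)) := by
  refine (mlieBracket_eq_lieBracket (mvfderiv_extChartAt_horLift cov w X)
    (mvfderiv_extChartAt_vertLift w Y)).trans ?_
  rw [extChartAt_tangent_self]
  refine (lieBracket_horizontal_vertical (hasFDerivAt_localRep hX) (hasFDerivAt_localRep hY)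
    (differentiableAt_christoffel cov w.1).hasFDerivAt w.2).trans ?_
  rw [vert_eq, cov_eq_christoffel cov hY, localRep_self, localRep_self]
  rfl

/-- For constant-coefficient fields $\nabla_YZ$ has coordinates $\Gamma(z,y)$ near `p`; applying
$d+\Gamma$ once more gives the two terms. -/
theorem cov_cov_extend (p : M) (x y z : TangentSpace 𝓘(ℝ, E) p) :
    (cov (fun q => cov (extend E z) q (extend E y q)) p x : E)
      = fderiv ℝ (christoffel cov p) (extChartAt 𝓘(ℝ, E) p p) x z y
        + christoffel cov p (extChartAt 𝓘(ℝ, E) p p)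
            (christoffel cov p (extChartAt 𝓘(ℝ, E) p p) z y) x := by
  have hp := mem_chart_source E p
  have hev : (fun q => coord p q (cov (extend E z) q (extend E y q))) =ᶠ[nhds p]
      fun q => christoffel cov p (extChartAt 𝓘(ℝ, E) p q) z y := by
    filter_upwards [(chartAt E p).open_source.mem_nhds hp] with q hq
    rw [cov_extend_eq cov hq, extend_eq_frame hq]
    refine (christoffel_apply cov hq z (frame (E := E) p y q)).symm.trans ?_
    exact congrArg _ (coord_frame hq y)
  have hΓ := hasFDerivAt_apply_apply (differentiableAt_christoffel cov p).hasFDerivAt z y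
  have hd : MDifferentiableAt 𝓘(ℝ, E) 𝓘(ℝ, E)
      (fun q => coord p q (cov (extend E z) q (extend E y q))) p := by
    refine MDifferentiableAt.congr_of_eventuallyEq ?_ hev
    exact hΓ.differentiableAt.mdifferentiableAt.comp p (mdifferentiableAt_extChartAt hp)
  have hs := (mdifferentiableAt_iff_coord hp (fun q => cov (extend E z) q (extend E y q))).2 hd
  have hev' : (fun x => (fun q => coord p q (cov (extend E z) q (extend E y q)))
      ((extChartAt 𝓘(ℝ, E) p).symm x)) =ᶠ[nhds (extChartAt 𝓘(ℝ, E) p p)]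
      fun x => christoffel cov p x z y := by
    have hc : Filter.Tendsto (extChartAt 𝓘(ℝ, E) p).symm (nhds (extChartAt 𝓘(ℝ, E) p p))
        (nhds p) := by
      have := continuousAt_extChartAt_symm (I := 𝓘(ℝ, E)) p
      rwa [ContinuousAt, extChartAt_to_inv] at this
    filter_upwards [extChartAt_target_mem_nhds (I := 𝓘(ℝ, E)) p, hc.eventually hev] with x hx hx'
    rw [hx', (extChartAt 𝓘(ℝ, E) p).right_inv hx]
  have hd' : HasFDerivAt (fun x => (fun q => coord p q (cov (extend E z) q (extend E y q)))
      ((extChartAt 𝓘(ℝ, E) p).symm x)) _ (extChartAt 𝓘(ℝ, E) p p) :=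
    hasFDerivAt_comp_extChartAt_symm hd
  have hD := HasFDerivAt.unique (𝕜 := ℝ) (E := E) (F := E) hd' (hΓ.congr_of_eventuallyEq hev')
  rw [cov_eq_christoffel cov hs, hD, extend_apply_self, cov_extend_eq cov hp,
    christoffel_self cov p z y]
  rfl

theorem curvature_eq_christoffel (p : M) (x y z : TangentSpace 𝓘(ℝ, E) p) :
    (curvature cov x y z : E)
      = fderiv ℝ (christoffel cov p) (extChartAt 𝓘(ℝ, E) p p) x z y
        + christoffel cov p (extChartAt 𝓘(ℝ, E) p p)
            (christoffel cov p (extChartAt 𝓘(ℝ, E) p p) z y) x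
        - (fderiv ℝ (christoffel cov p) (extChartAt 𝓘(ℝ, E) p p) y z x
          + christoffel cov p (extChartAt 𝓘(ℝ, E) p p)
            (christoffel cov p (extChartAt 𝓘(ℝ, E) p p) z x) y) := by
  -- Fields constant in the trivialization are constant in the chart, so they commute and the last
  -- curvature term drops out.
  have hb : mlieBracket 𝓘(ℝ, E) (extend E x) (extend E y) p = 0 := by
    have key (v : TangentSpace 𝓘(ℝ, E) p) :
        (fun q => mvfderiv 𝓘(ℝ, E) (extChartAt 𝓘(ℝ, E) p) q (extend E v q))
          =ᶠ[nhds p] (fun _ : E => (v : E)) ∘ extChartAt 𝓘(ℝ, E) p := by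
      filter_upwards [(chartAt E p).open_source.mem_nhds (mem_chart_source E p)] with q hq
      rw [extend_eq_frame hq]
      refine Eq.trans ?_ (coord_frame hq v)
      rw [coord_eq_mfderiv hq]
      rfl
    refine (mlieBracket_eq_lieBracket (key x) (key y)).trans ?_
    exact lieBracket_const (E := E) x y _
  rw [curvature, curvatureField, hb, map_zero, sub_zero, extend_apply_self, extend_apply_self]
  exact congrArg₂ (fun a b : E => a - b) (cov_cov_extend cov p x y z) (cov_cov_extend cov p y x z)

theorem mlieBracket_horLift_horLift
    (hX : MDifferentiableAt 𝓘(ℝ, E) 𝓘(ℝ, E).tangent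
      (fun q => (⟨q, X q⟩ : TangentBundle 𝓘(ℝ, E) M)) w.1)
    (hY : MDifferentiableAt 𝓘(ℝ, E) 𝓘(ℝ, E).tangent
      (fun q => (⟨q, Y q⟩ : TangentBundle 𝓘(ℝ, E) M)) w.1) :
    mlieBracket 𝓘(ℝ, E).tangent (horLift cov X) (horLift cov Y) w
      = hor cov w (mlieBracket 𝓘(ℝ, E) X Y w.1) - vert w (curvature cov (X w.1) (Y w.1) w.2) := by
  refine (mlieBracket_eq_lieBracket (mvfderiv_extChartAt_horLift cov w X)
    (mvfderiv_extChartAt_horLift cov w Y)).trans ?_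
  rw [extChartAt_tangent_self]
  refine (lieBracket_horizontal_horizontal (hasFDerivAt_localRep hX) (hasFDerivAt_localRep hY)
    (differentiableAt_christoffel cov w.1).hasFDerivAt w.2).trans ?_
  rw [vert_eq, hor_eq, mlieBracket_eq_lieBracket_localRep, cov_extend_eq cov (mem_chart_source E _),
    localRep_self, localRep_self]
  refine Prod.ext (sub_zero _).symm ?_
  exact (congrArg₂ (fun a b : E => -a - b) (christoffel_self cov w.1 w.2 _).symm
    (curvature_eq_christoffel cov w.1 (X w.1) (Y w.1) w.2)).symm

end Lifts

end Bracket

/-! ### Signs, linearity of lifts, and the tensor $\nabla J$. -/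

section Tensor

section Neg

variable {F : Type*} [NormedAddCommGroup F] [NormedSpace ℝ F]
  {H : Type*} [TopologicalSpace H] {I : ModelWithCorners ℝ F H}
  {N : Type*} [TopologicalSpace N] [ChartedSpace H N]

theorem lieBracketWithin_neg_left (V W : F → F) {s : Set F} {x : F}
    (hs : UniqueDiffWithinAt ℝ s x) :
    lieBracketWithin ℝ (-V) W s x = -lieBracketWithin ℝ V W s x := by
  simp only [lieBracketWithin, fderivWithin_neg hs, Pi.neg_apply, map_neg, neg_apply]
  abel

/-- Derivatives commute with negation even where they take the default value zero. The signs in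
$J_1$ and $J_3$ can thus be extracted without discussing differentiability of the lifts on $TM$. -/
theorem mlieBracket_neg_left (V W : ∀ x : N, TangentSpace I x) (x : N) :
    mlieBracket I (-V) W x = -mlieBracket I V W x := by
  rw [← mlieBracketWithin_univ, ← mlieBracketWithin_univ, mlieBracketWithin_apply,
    mlieBracketWithin_apply, mpullbackWithin_neg]
  have hs : UniqueDiffWithinAt ℝ ((extChartAt I x).symm ⁻¹' Set.univ ∩ Set.range I)
      (extChartAt I x x) := by
    rw [Set.preimage_univ, Set.univ_inter]
    exact I.uniqueDiffOn _ (extChartAt_target_subset_range x (mem_extChartAt_target x))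
  exact (congrArg (mfderiv I 𝓘(ℝ, F) (extChartAt I x) x).inverse
    (lieBracketWithin_neg_left (F := F) _ _ hs)).trans (map_neg _ _)

theorem mlieBracket_neg_right (V W : ∀ x : N, TangentSpace I x) (x : N) :
    mlieBracket I V (-W) x = -mlieBracket I V W x := by
  rw [mlieBracket_swap_apply, mlieBracket_neg_left, mlieBracket_swap_apply (V := W), neg_neg]

end Neg

variable {E : Type*} [NormedAddCommGroup E] [NormedSpace ℝ E]
  {M : Type*} [TopologicalSpace M] [ChartedSpace E M] [IsManifold 𝓘(ℝ, E) ∞ M]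

theorem SmoothField.mdifferentiableAt {X : ∀ p : M, TangentSpace 𝓘(ℝ, E) p} (hX : SmoothField X)
    (p : M) : MDifferentiableAt 𝓘(ℝ, E) 𝓘(ℝ, E).tangent
      (fun q => (⟨q, X q⟩ : TangentBundle 𝓘(ℝ, E) M)) p :=
  (hX p).mdifferentiableAt (by simp)

variable {J : ∀ p : M, TangentSpace 𝓘(ℝ, E) p →L[ℝ] TangentSpace 𝓘(ℝ, E) p}

theorem IsAlmostComplex.smoothField (hJ : IsAlmostComplex J)
    {X : ∀ p : M, TangentSpace 𝓘(ℝ, E) p} (hX : SmoothField X) :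
    SmoothField (fun q => J q (X q)) :=
  hJ.smooth.clm_bundle_apply hX

theorem IsAlmostComplex.mdifferentiableAt (hJ : IsAlmostComplex J)
    {X : ∀ p : M, TangentSpace 𝓘(ℝ, E) p} {p : M}
    (hX : MDifferentiableAt 𝓘(ℝ, E) 𝓘(ℝ, E).tangent
      (fun q => (⟨q, X q⟩ : TangentBundle 𝓘(ℝ, E) M)) p) :
    MDifferentiableAt 𝓘(ℝ, E) 𝓘(ℝ, E).tangent
      (fun q => (⟨q, J q (X q)⟩ : TangentBundle 𝓘(ℝ, E) M)) p :=
  ((hJ.smooth p).mdifferentiableAt (by simp)).clm_bundle_apply hX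

section Linearity

variable (cov : Connection E M)

theorem vert_add (w : TangentBundle 𝓘(ℝ, E) M) (a b : TangentSpace 𝓘(ℝ, E) w.1) :
    vert w (a + b) = vert w a + vert w b := by
  rw [vert_eq, vert_eq, vert_eq]
  exact Prod.ext (add_zero (0 : E)).symm rfl

theorem hor_add (w : TangentBundle 𝓘(ℝ, E) M) (a b : TangentSpace 𝓘(ℝ, E) w.1) :
    hor cov w (a + b) = hor cov w a + hor cov w b := by
  have h := (splitting cov w).map_add (a, 0) (b, 0)
  simpa [splitting_apply, vert_zero] using h

theorem vert_neg (w : TangentBundle 𝓘(ℝ, E) M) (a : TangentSpace 𝓘(ℝ, E) w.1) :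
    vert w (-a) = -vert w a := by
  rw [eq_neg_iff_add_eq_zero, ← vert_add, neg_add_cancel, vert_zero]

theorem hor_neg (w : TangentBundle 𝓘(ℝ, E) M) (a : TangentSpace 𝓘(ℝ, E) w.1) :
    hor cov w (-a) = -hor cov w a := by
  rw [eq_neg_iff_add_eq_zero, ← hor_add, neg_add_cancel, hor_zero]

theorem vert_sub (w : TangentBundle 𝓘(ℝ, E) M) (a b : TangentSpace 𝓘(ℝ, E) w.1) :
    vert w (a - b) = vert w a - vert w b := by
  rw [sub_eq_add_neg, vert_add, vert_neg, ← sub_eq_add_neg]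

theorem hor_sub (w : TangentBundle 𝓘(ℝ, E) M) (a b : TangentSpace 𝓘(ℝ, E) w.1) :
    hor cov w (a - b) = hor cov w a - hor cov w b := by
  rw [sub_eq_add_neg, hor_add, hor_neg, ← sub_eq_add_neg]

theorem J₃_hor (w : TangentBundle 𝓘(ℝ, E) M) (a : TangentSpace 𝓘(ℝ, E) w.1) :
    J₃ cov J w (hor cov w a) = -hor cov w (J w.1 a) := by
  rw [J₃, ContinuousLinearMap.comp_apply, J₂_hor, J₁_vert]

theorem J₃_vert (w : TangentBundle 𝓘(ℝ, E) M) (a : TangentSpace 𝓘(ℝ, E) w.1) :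
    J₃ cov J w (vert w a) = vert w (J w.1 a) := by
  rw [J₃, ContinuousLinearMap.comp_apply, J₂_vert, J₁_hor]

variable (X : ∀ p : M, TangentSpace 𝓘(ℝ, E) p)

theorem J₁_horLift : (fun w => J₁ cov w (horLift cov X w)) = vertLift X :=
  funext fun w => J₁_hor cov w (X w.1)

theorem J₁_vertLift : (fun w => J₁ cov w (vertLift X w)) = -horLift cov X :=
  funext fun w => J₁_vert cov w (X w.1)

theorem J₂_horLift :
    (fun w => J₂ cov J w (horLift cov X w)) = vertLift fun q => J q (X q) :=
  funext fun w => J₂_hor cov J w (X w.1)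

theorem J₂_vertLift :
    (fun w => J₂ cov J w (vertLift X w)) = horLift cov fun q => J q (X q) :=
  funext fun w => J₂_vert cov J w (X w.1)

theorem J₃_horLift :
    (fun w => J₃ cov J w (horLift cov X w)) = -horLift cov fun q => J q (X q) :=
  funext fun w => J₃_hor cov w (X w.1)

theorem J₃_vertLift :
    (fun w => J₃ cov J w (vertLift X w)) = vertLift fun q => J q (X q) :=
  funext fun w => J₃_vert cov w (X w.1)

end Linearity

variable (cov : Connection E M)

/-- Both Leibniz terms equal $df(x)\,JY$, because `J` is linear on each fibre. -/
theorem IsAlmostComplex.tensorialAt_nablaEnd (hJ : IsAlmostComplex J) {p : M}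
    (x : TangentSpace 𝓘(ℝ, E) p) :
    TensorialAt 𝓘(ℝ, E) E (fun Y : ∀ q : M, TangentSpace 𝓘(ℝ, E) q =>
      cov (fun q => J q (Y q)) p x - J p (cov Y p x)) p where
  smul {f s} hf hs := by
    have h1 : (fun q => J q ((f • s) q)) = f • fun q => J q (s q) := by
      funext q; exact (J q).map_smul (f q) (s q)
    rw [h1, cov.isCovariantDerivativeOnUniv.leibniz hs hf,
      cov.isCovariantDerivativeOnUniv.leibniz (hJ.mdifferentiableAt hs) hf]
    simp only [add_apply, smul_apply, ContinuousLinearMap.smulRight_apply, map_add, map_smul]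
    module
  add {s s'} hs hs' := by
    have h1 : (fun q => J q ((s + s') q)) = (fun q => J q (s q)) + fun q => J q (s' q) := by
      funext q; exact (J q).map_add (s q) (s' q)
    rw [h1, cov.isCovariantDerivativeOnUniv.add hs hs',
      cov.isCovariantDerivativeOnUniv.add (hJ.mdifferentiableAt hs) (hJ.mdifferentiableAt hs')]
    simp only [add_apply, map_add]
    abel

variable [FiniteDimensional ℝ E]

theorem IsAlmostComplex.nablaEnd_eq (hJ : IsAlmostComplex J)
    {Y : ∀ p : M, TangentSpace 𝓘(ℝ, E) p} {p : M}
    (hY : MDifferentiableAt 𝓘(ℝ, E) 𝓘(ℝ, E).tangent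
      (fun q => (⟨q, Y q⟩ : TangentBundle 𝓘(ℝ, E) M)) p) (x : TangentSpace 𝓘(ℝ, E) p) :
    nablaEnd cov J x (Y p) = cov (fun q => J q (Y q)) p x - J p (cov Y p x) :=
  (hJ.tensorialAt_nablaEnd cov x).pointwise (mdifferentiableAt_extend ..) hY
    (extend_apply_self E (Y p))

/-- The preceding formula for the field $JY$, with $J(JY)=-Y$; it serves the mixed components of
$N_3$. -/
theorem IsAlmostComplex.nablaEnd_eq' (hJ : IsAlmostComplex J)
    {Y : ∀ p : M, TangentSpace 𝓘(ℝ, E) p} {p : M}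
    (hY : MDifferentiableAt 𝓘(ℝ, E) 𝓘(ℝ, E).tangent
      (fun q => (⟨q, Y q⟩ : TangentBundle 𝓘(ℝ, E) M)) p) (x : TangentSpace 𝓘(ℝ, E) p) :
    nablaEnd cov J x (J p (Y p)) = -cov Y p x - J p (cov (fun q => J q (Y q)) p x) := by
  have h := hJ.nablaEnd_eq cov (hJ.mdifferentiableAt hY) x
  have h1 : (fun q => J q (J q (Y q))) = (-1 : ℝ) • Y := by
    funext q; exact (hJ.sq_eq_neg q (Y q)).trans (neg_one_smul ℝ (Y q)).symm
  rw [h1, cov.isCovariantDerivativeOnUniv.smul_const _ hY] at h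
  refine h.trans ?_
  rw [neg_one_smul]
  rfl

variable {cov} in
theorem mlieBracket_of_torsion_eq_zero (hcov : cov.torsion = 0)
    {X Y : ∀ q : M, TangentSpace 𝓘(ℝ, E) q} (hX : SmoothField X) (hY : SmoothField Y) (p : M) :
    mlieBracket 𝓘(ℝ, E) X Y p = cov Y p (X p) - cov X p (Y p) :=
  (cov.torsion_eq_zero_iff.1 hcov (hX.mdifferentiableAt p) (hY.mdifferentiableAt p)).symm

theorem IsAlmostComplex.nijenhuis_eq (hJ : IsAlmostComplex J) (hcov : cov.torsion = 0)
    {X Y : ∀ q : M, TangentSpace 𝓘(ℝ, E) q} (hX : SmoothField X) (hY : SmoothField Y) (p : M) :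
    nijenhuis 𝓘(ℝ, E) J X Y p
      = J p (nablaEnd cov J (X p) (Y p)) - J p (nablaEnd cov J (Y p) (X p))
        - nablaEnd cov J (J p (X p)) (Y p) + nablaEnd cov J (J p (Y p)) (X p) := by
  have hJX := hJ.smoothField hX
  have hJY := hJ.smoothField hY
  rw [nijenhuis, mlieBracket_of_torsion_eq_zero hcov hX hY,
    mlieBracket_of_torsion_eq_zero hcov hJX hY, mlieBracket_of_torsion_eq_zero hcov hX hJY,
    mlieBracket_of_torsion_eq_zero hcov hJX hJY]
  simp only [hJ.nablaEnd_eq cov (hX.mdifferentiableAt p),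
    hJ.nablaEnd_eq cov (hY.mdifferentiableAt p), map_sub, hJ.sq_eq_neg]
  abel

/-! ### The components of $N_1$, $N_2$, $N_3$ on lifts. -/

section Nijenhuis

variable [T2Space M] [CovariantDerivative.ContMDiffCovariantDerivative cov ∞]
  {X Y : ∀ q : M, TangentSpace 𝓘(ℝ, E) q}

theorem mlieBracket_vertLift_horLift (hX : SmoothField X) (hY : SmoothField Y)
    (w : TangentBundle 𝓘(ℝ, E) M) :
    mlieBracket 𝓘(ℝ, E).tangent (vertLift X) (horLift cov Y) w
      = -vert w (cov X w.1 (Y w.1)) := by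
  rw [mlieBracket_swap_apply, mlieBracket_horLift_vertLift cov (hY.mdifferentiableAt _)
    (hX.mdifferentiableAt _)]

variable {cov} in
theorem mlieBracket_horLift_horLift_of_torsion_eq_zero (hcov : cov.torsion = 0)
    (hX : SmoothField X) (hY : SmoothField Y) (w : TangentBundle 𝓘(ℝ, E) M) :
    mlieBracket 𝓘(ℝ, E).tangent (horLift cov X) (horLift cov Y) w
      = hor cov w (cov Y w.1 (X w.1)) - hor cov w (cov X w.1 (Y w.1))
        - vert w (curvature cov (X w.1) (Y w.1) w.2) := by
  rw [mlieBracket_horLift_horLift cov (hX.mdifferentiableAt _) (hY.mdifferentiableAt _),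
    mlieBracket_of_torsion_eq_zero hcov hX hY, hor_sub]

variable {cov}

/-- The two mixed brackets, sent back by $J_1$, cancel $(\nabla_XY-\nabla_YX)^H$; only the curvature
of the horizontal bracket is left. -/
theorem nijenhuis_J₁_horLift_horLift (hcov : cov.torsion = 0)
    (hX : SmoothField X) (hY : SmoothField Y) (w : TangentBundle 𝓘(ℝ, E) M) :
    nijenhuis 𝓘(ℝ, E).tangent (J₁ (M := M) cov) (horLift cov X) (horLift cov Y) w
      = -vert w (curvature cov (X w.1) (Y w.1) w.2) := by
  rw [nijenhuis, J₁_horLift, J₁_horLift]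
  rw [mlieBracket_horLift_horLift_of_torsion_eq_zero hcov hX hY,
    mlieBracket_vertLift_horLift cov hX hY,
    mlieBracket_horLift_vertLift cov (hX.mdifferentiableAt _) (hY.mdifferentiableAt _),
    mlieBracket_vertLift_vertLift (hX.mdifferentiableAt _) (hY.mdifferentiableAt _)]
  simp only [map_neg, J₁_vert]
  abel

theorem nijenhuis_J₁_vertLift_vertLift (hcov : cov.torsion = 0)
    (hX : SmoothField X) (hY : SmoothField Y) (w : TangentBundle 𝓘(ℝ, E) M) :
    nijenhuis 𝓘(ℝ, E).tangent (J₁ (M := M) cov) (vertLift X) (vertLift Y) w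
      = vert w (curvature cov (X w.1) (Y w.1) w.2) := by
  rw [nijenhuis, J₁_vertLift, J₁_vertLift]
  simp only [mlieBracket_neg_left, mlieBracket_neg_right]
  rw [mlieBracket_vertLift_vertLift (hX.mdifferentiableAt _) (hY.mdifferentiableAt _),
    mlieBracket_horLift_vertLift cov (hX.mdifferentiableAt _) (hY.mdifferentiableAt _),
    mlieBracket_vertLift_horLift cov hX hY,
    mlieBracket_horLift_horLift_of_torsion_eq_zero hcov hX hY]
  simp only [map_neg, J₁_vert]
  abel

theorem nijenhuis_J₁_horLift_vertLift (hcov : cov.torsion = 0)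
    (hX : SmoothField X) (hY : SmoothField Y) (w : TangentBundle 𝓘(ℝ, E) M) :
    nijenhuis 𝓘(ℝ, E).tangent (J₁ (M := M) cov) (horLift cov X) (vertLift Y) w
      = -hor cov w (curvature cov (X w.1) (Y w.1) w.2) := by
  rw [nijenhuis, J₁_horLift, J₁_vertLift]
  simp only [mlieBracket_neg_right]
  rw [mlieBracket_horLift_vertLift cov (hX.mdifferentiableAt _) (hY.mdifferentiableAt _),
    mlieBracket_vertLift_vertLift (hX.mdifferentiableAt _) (hY.mdifferentiableAt _),
    mlieBracket_horLift_horLift_of_torsion_eq_zero hcov hX hY,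
    mlieBracket_vertLift_horLift cov hX hY]
  simp only [map_neg, map_sub, map_zero, J₁_hor, J₁_vert]
  abel

theorem nijenhuis_J₁_vertLift_horLift (hcov : cov.torsion = 0)
    (hX : SmoothField X) (hY : SmoothField Y) (w : TangentBundle 𝓘(ℝ, E) M) :
    nijenhuis 𝓘(ℝ, E).tangent (J₁ (M := M) cov) (vertLift X) (horLift cov Y) w
      = -hor cov w (curvature cov (X w.1) (Y w.1) w.2) := by
  rw [nijenhuis, J₁_vertLift, J₁_horLift]
  simp only [mlieBracket_neg_left]
  rw [mlieBracket_vertLift_horLift cov hX hY,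
    mlieBracket_horLift_horLift_of_torsion_eq_zero hcov hX hY,
    mlieBracket_vertLift_vertLift (hX.mdifferentiableAt _) (hY.mdifferentiableAt _),
    mlieBracket_horLift_vertLift cov (hX.mdifferentiableAt _) (hY.mdifferentiableAt _)]
  simp only [map_neg, map_sub, map_zero, J₁_hor, J₁_vert]
  abel

/-- Here $J^2=-1$ turns $\nabla_XY+J\nabla_X(JY)$ into $J(\nabla_XJ)(Y)$. -/
theorem nijenhuis_J₂_horLift_horLift (hJ : IsAlmostComplex J) (hcov : cov.torsion = 0)
    (hX : SmoothField X) (hY : SmoothField Y) (w : TangentBundle 𝓘(ℝ, E) M) :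
    nijenhuis 𝓘(ℝ, E).tangent (J₂ cov J) (horLift cov X) (horLift cov Y) w
      = hor cov w (J w.1 (nablaEnd cov J (X w.1) (Y w.1)) - J w.1 (nablaEnd cov J (Y w.1) (X w.1)))
        - vert w (curvature cov (X w.1) (Y w.1) w.2) := by
  have hJX := hJ.smoothField hX
  have hJY := hJ.smoothField hY
  rw [nijenhuis, J₂_horLift, J₂_horLift]
  rw [mlieBracket_horLift_horLift_of_torsion_eq_zero hcov hX hY,
    mlieBracket_vertLift_horLift cov hJX hY,
    mlieBracket_horLift_vertLift cov (hX.mdifferentiableAt _) (hJY.mdifferentiableAt _),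
    mlieBracket_vertLift_vertLift (hJX.mdifferentiableAt _) (hJY.mdifferentiableAt _)]
  simp only [hJ.nablaEnd_eq cov (hX.mdifferentiableAt _),
    hJ.nablaEnd_eq cov (hY.mdifferentiableAt _), hJ.sq_eq_neg, map_neg, map_sub, J₂_vert, hor_sub,
    hor_neg]
  abel

theorem nijenhuis_J₂_vertLift_vertLift (hJ : IsAlmostComplex J) (hcov : cov.torsion = 0)
    (hX : SmoothField X) (hY : SmoothField Y) (w : TangentBundle 𝓘(ℝ, E) M) :
    nijenhuis 𝓘(ℝ, E).tangent (J₂ cov J) (vertLift X) (vertLift Y) w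
      = -hor cov w (nablaEnd cov J (J w.1 (X w.1)) (Y w.1) - nablaEnd cov J (J w.1 (Y w.1)) (X w.1))
        + vert w (curvature cov (J w.1 (X w.1)) (J w.1 (Y w.1)) w.2) := by
  have hJX := hJ.smoothField hX
  have hJY := hJ.smoothField hY
  rw [nijenhuis, J₂_vertLift, J₂_vertLift]
  rw [mlieBracket_vertLift_vertLift (hX.mdifferentiableAt _) (hY.mdifferentiableAt _),
    mlieBracket_horLift_vertLift cov (hJX.mdifferentiableAt _) (hY.mdifferentiableAt _),
    mlieBracket_vertLift_horLift cov hX hJY,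
    mlieBracket_horLift_horLift_of_torsion_eq_zero hcov hJX hJY]
  simp only [hJ.nablaEnd_eq cov (hX.mdifferentiableAt _),
    hJ.nablaEnd_eq cov (hY.mdifferentiableAt _), map_neg, J₂_vert, hor_sub]
  abel

theorem nijenhuis_J₂_horLift_vertLift (hJ : IsAlmostComplex J) (hcov : cov.torsion = 0)
    (hX : SmoothField X) (hY : SmoothField Y) (w : TangentBundle 𝓘(ℝ, E) M) :
    nijenhuis 𝓘(ℝ, E).tangent (J₂ cov J) (horLift cov X) (vertLift Y) w
      = vert w (J w.1 (nablaEnd cov J (X w.1) (Y w.1)) + nablaEnd cov J (J w.1 (Y w.1)) (X w.1))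
        - hor cov w (J w.1 (curvature cov (X w.1) (J w.1 (Y w.1)) w.2)) := by
  have hJX := hJ.smoothField hX
  have hJY := hJ.smoothField hY
  rw [nijenhuis, J₂_horLift, J₂_vertLift]
  rw [mlieBracket_horLift_vertLift cov (hX.mdifferentiableAt _) (hY.mdifferentiableAt _),
    mlieBracket_vertLift_vertLift (hJX.mdifferentiableAt _) (hY.mdifferentiableAt _),
    mlieBracket_horLift_horLift_of_torsion_eq_zero hcov hX hJY,
    mlieBracket_vertLift_horLift cov hJX hJY]
  simp only [hJ.nablaEnd_eq cov (hX.mdifferentiableAt _),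
    hJ.nablaEnd_eq cov (hY.mdifferentiableAt _), hJ.sq_eq_neg, map_sub, map_zero, J₂_hor, J₂_vert,
    vert_add, vert_sub, vert_neg]
  abel

theorem nijenhuis_J₂_vertLift_horLift (hJ : IsAlmostComplex J) (hcov : cov.torsion = 0)
    (hX : SmoothField X) (hY : SmoothField Y) (w : TangentBundle 𝓘(ℝ, E) M) :
    nijenhuis 𝓘(ℝ, E).tangent (J₂ cov J) (vertLift X) (horLift cov Y) w
      = -vert w (nablaEnd cov J (J w.1 (X w.1)) (Y w.1) + J w.1 (nablaEnd cov J (Y w.1) (X w.1)))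
        - hor cov w (J w.1 (curvature cov (J w.1 (X w.1)) (Y w.1) w.2)) := by
  have hJX := hJ.smoothField hX
  have hJY := hJ.smoothField hY
  rw [nijenhuis, J₂_vertLift, J₂_horLift]
  rw [mlieBracket_vertLift_horLift cov hX hY,
    mlieBracket_horLift_horLift_of_torsion_eq_zero hcov hJX hY,
    mlieBracket_vertLift_vertLift (hX.mdifferentiableAt _) (hJY.mdifferentiableAt _),
    mlieBracket_horLift_vertLift cov (hJX.mdifferentiableAt _) (hJY.mdifferentiableAt _)]
  simp only [hJ.nablaEnd_eq cov (hX.mdifferentiableAt _),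
    hJ.nablaEnd_eq cov (hY.mdifferentiableAt _), hJ.sq_eq_neg, map_sub, map_zero, J₂_hor, J₂_vert,
    vert_add, vert_sub, vert_neg]
  abel

/-- As $J_3$ preserves horizontality, all four brackets are horizontal-horizontal, and each
contributes one curvature term. -/
theorem nijenhuis_J₃_horLift_horLift (hJ : IsAlmostComplex J) (hcov : cov.torsion = 0)
    (hX : SmoothField X) (hY : SmoothField Y) (w : TangentBundle 𝓘(ℝ, E) M) :
    nijenhuis 𝓘(ℝ, E).tangent (J₃ cov J) (horLift cov X) (horLift cov Y) w
      = hor cov w (J w.1 (nablaEnd cov J (X w.1) (Y w.1)) - J w.1 (nablaEnd cov J (Y w.1) (X w.1))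
          - nablaEnd cov J (J w.1 (X w.1)) (Y w.1) + nablaEnd cov J (J w.1 (Y w.1)) (X w.1))
        + vert w (-curvature cov (X w.1) (Y w.1) w.2 + curvature cov (J w.1 (X w.1)) (J w.1 (Y w.1)) w.2
          + J w.1 (curvature cov (J w.1 (X w.1)) (Y w.1) w.2)
          + J w.1 (curvature cov (X w.1) (J w.1 (Y w.1)) w.2)) := by
  have hJX := hJ.smoothField hX
  have hJY := hJ.smoothField hY
  rw [nijenhuis, J₃_horLift, J₃_horLift]
  simp only [mlieBracket_neg_left, mlieBracket_neg_right]
  rw [mlieBracket_horLift_horLift_of_torsion_eq_zero hcov hX hY,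
    mlieBracket_horLift_horLift_of_torsion_eq_zero hcov hJX hY,
    mlieBracket_horLift_horLift_of_torsion_eq_zero hcov hX hJY,
    mlieBracket_horLift_horLift_of_torsion_eq_zero hcov hJX hJY]
  simp only [hJ.nablaEnd_eq cov (hX.mdifferentiableAt _),
    hJ.nablaEnd_eq cov (hY.mdifferentiableAt _), hJ.sq_eq_neg, map_neg, map_sub, J₃_hor, J₃_vert,
    hor_add, hor_sub, hor_neg, vert_add, vert_neg]
  abel

/-- As $J_3$ preserves both distributions, only mixed brackets occur: the result is vertical and
free of curvature. -/
theorem nijenhuis_J₃_horLift_vertLift (hJ : IsAlmostComplex J)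
    (hX : SmoothField X) (hY : SmoothField Y) (w : TangentBundle 𝓘(ℝ, E) M) :
    nijenhuis 𝓘(ℝ, E).tangent (J₃ cov J) (horLift cov X) (vertLift Y) w
      = vert w (nablaEnd cov J (J w.1 (X w.1)) (Y w.1) - nablaEnd cov J (X w.1) (J w.1 (Y w.1))) := by
  have hJX := hJ.smoothField hX
  have hJY := hJ.smoothField hY
  rw [nijenhuis, J₃_horLift, J₃_vertLift]
  simp only [mlieBracket_neg_left]
  rw [mlieBracket_horLift_vertLift cov (hX.mdifferentiableAt _) (hY.mdifferentiableAt _),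
    mlieBracket_horLift_vertLift cov (hJX.mdifferentiableAt _) (hY.mdifferentiableAt _),
    mlieBracket_horLift_vertLift cov (hX.mdifferentiableAt _) (hJY.mdifferentiableAt _),
    mlieBracket_horLift_vertLift cov (hJX.mdifferentiableAt _) (hJY.mdifferentiableAt _)]
  simp only [hJ.nablaEnd_eq cov (hY.mdifferentiableAt _),
    hJ.nablaEnd_eq' cov (hY.mdifferentiableAt _), map_neg, J₃_vert, vert_sub, vert_neg]
  abel

theorem nijenhuis_J₃_vertLift_horLift (hJ : IsAlmostComplex J)
    (hX : SmoothField X) (hY : SmoothField Y) (w : TangentBundle 𝓘(ℝ, E) M) :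
    nijenhuis 𝓘(ℝ, E).tangent (J₃ cov J) (vertLift X) (horLift cov Y) w
      = vert w (nablaEnd cov J (Y w.1) (J w.1 (X w.1)) - nablaEnd cov J (J w.1 (Y w.1)) (X w.1)) := by
  have hJX := hJ.smoothField hX
  have hJY := hJ.smoothField hY
  rw [nijenhuis, J₃_vertLift, J₃_horLift]
  simp only [mlieBracket_neg_right]
  rw [mlieBracket_vertLift_horLift cov hX hY,
    mlieBracket_vertLift_horLift cov hJX hY,
    mlieBracket_vertLift_horLift cov hX hJY,
    mlieBracket_vertLift_horLift cov hJX hJY]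
  simp only [hJ.nablaEnd_eq cov (hX.mdifferentiableAt _),
    hJ.nablaEnd_eq' cov (hX.mdifferentiableAt _), map_neg, J₃_vert, vert_sub, vert_neg]
  abel

theorem nijenhuis_J₃_vertLift_vertLift (hJ : IsAlmostComplex J)
    (hX : SmoothField X) (hY : SmoothField Y) (w : TangentBundle 𝓘(ℝ, E) M) :
    nijenhuis 𝓘(ℝ, E).tangent (J₃ cov J) (vertLift X) (vertLift Y) w = 0 := by
  have hJX := hJ.smoothField hX
  have hJY := hJ.smoothField hY
  rw [nijenhuis, J₃_vertLift, J₃_vertLift]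
  rw [mlieBracket_vertLift_vertLift (hX.mdifferentiableAt _) (hY.mdifferentiableAt _),
    mlieBracket_vertLift_vertLift (hJX.mdifferentiableAt _) (hY.mdifferentiableAt _),
    mlieBracket_vertLift_vertLift (hX.mdifferentiableAt _) (hJY.mdifferentiableAt _),
    mlieBracket_vertLift_vertLift (hJX.mdifferentiableAt _) (hJY.mdifferentiableAt _)]
  simp only [map_zero]
  abel

end Nijenhuis

end Tensor

end LiftGeometry

end

theorem mainTheorem7
    {E : Type*} [NormedAddCommGroup E] [NormedSpace ℝ E] [FiniteDimensional ℝ E]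
    {M : Type*} [TopologicalSpace M] [T2Space M] [ChartedSpace E M] [IsManifold 𝓘(ℝ, E) ∞ M]
    (J : ∀ p : M, TangentSpace 𝓘(ℝ, E) p →L[ℝ] TangentSpace 𝓘(ℝ, E) p)
    (hJ : IsAlmostComplex J)
    (cov : Connection E M) [CovariantDerivative.ContMDiffCovariantDerivative cov ∞]
    (hcov : cov.torsion = 0)
    (X Y : ∀ p : M, TangentSpace 𝓘(ℝ, E) p) (hX : SmoothField X) (hY : SmoothField Y)
    (p : M) (u : TangentSpace 𝓘(ℝ, E) p) :
    -- the values at `p` of `X`, `Y`, `JX`, `JY`, the point `u` of `TM`, and the tensors `R` and `∇J`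
    let x := X p
    let y := Y p
    let Jx := J p (X p)
    let Jy := J p (Y p)
    let w : TangentBundle 𝓘(ℝ, E) M := ⟨p, u⟩
    let R := fun a b : TangentSpace 𝓘(ℝ, E) p => curvature cov a b u
    let DJ := fun a b : TangentSpace 𝓘(ℝ, E) p => nablaEnd cov J a b
    let Xh := horLift cov X
    let Yh := horLift cov Y
    let Xv := vertLift X
    let Yv := vertLift Y
    let N₁ := nijenhuis 𝓘(ℝ, E).tangent (J₁ (M := M) cov)
    let N₂ := nijenhuis 𝓘(ℝ, E).tangent (J₂ cov J)
    let N₃ := nijenhuis 𝓘(ℝ, E).tangent (J₃ cov J)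
    -- `N₁`
    (-N₁ Xh Yh w = vert w (R x y) ∧
      N₁ Xv Yv w = vert w (R x y) ∧
      N₁ Xh Yv w = -hor cov w (R x y) ∧
      N₁ Xv Yh w = -hor cov w (R x y)) ∧
    -- `N₂`
    (N₂ Xh Yh w = hor cov w (J p (DJ x y) - J p (DJ y x)) - vert w (R x y) ∧
      N₂ Xv Yv w = -hor cov w (DJ Jx y - DJ Jy x) + vert w (R Jx Jy) ∧
      N₂ Xh Yv w = vert w (J p (DJ x y) + DJ Jy x) - hor cov w (J p (R x Jy)) ∧
      N₂ Xv Yh w = -vert w (DJ Jx y + J p (DJ y x)) - hor cov w (J p (R Jx y))) ∧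
    -- `N₃`
    (N₃ Xh Yh w = hor cov w (J p (DJ x y) - J p (DJ y x) - DJ Jx y + DJ Jy x)
        + vert w (-R x y + R Jx Jy + J p (R Jx y) + J p (R x Jy)) ∧
      N₃ Xh Yv w = vert w (DJ Jx y - DJ x Jy) ∧
      N₃ Xv Yh w = vert w (DJ y Jx - DJ Jy x) ∧
      N₃ Xv Yv w = 0) ∧
    -- the horizontal part of `N₃(X^H, Y^H)` is the lift of the Nijenhuis tensor of `J` itself
    nijenhuis 𝓘(ℝ, E) J X Y p = J p (DJ x y) - J p (DJ y x) - DJ Jx y + DJ Jy x := by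
  intro x y Jx Jy w R DJ Xh Yh Xv Yv N₁ N₂ N₃
  refine ⟨⟨?_, nijenhuis_J₁_vertLift_vertLift hcov hX hY w,
      nijenhuis_J₁_horLift_vertLift hcov hX hY w, nijenhuis_J₁_vertLift_horLift hcov hX hY w⟩,
    ⟨nijenhuis_J₂_horLift_horLift hJ hcov hX hY w, nijenhuis_J₂_vertLift_vertLift hJ hcov hX hY w,
      nijenhuis_J₂_horLift_vertLift hJ hcov hX hY w,
      nijenhuis_J₂_vertLift_horLift hJ hcov hX hY w⟩,
    ⟨nijenhuis_J₃_horLift_horLift hJ hcov hX hY w, nijenhuis_J₃_horLift_vertLift hJ hX hY w,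
      nijenhuis_J₃_vertLift_horLift hJ hX hY w,
      nijenhuis_J₃_vertLift_vertLift hJ hX hY w⟩,
    hJ.nijenhuis_eq cov hcov hX hY p⟩
  exact neg_eq_iff_eq_neg.2 (nijenhuis_J₁_horLift_horLift hcov hX hY w)
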